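/- Let $p$ be a prime and $n\ge 1$, and let $\mathcal A$ be the mod-$p$ Steenrod algebra. Let $D_n=\mathbb F_p[y_1,\dots,y_n]^{GL_n(\mathbb F_p)}$ be the classical Dickson algebra, where $|y_i|=2$ if $p$ is odd and $|y_i|=1$ if $p=2$; it is a graded $\mathcal A$-module through the action of $\mathcal A$ on $\mathbb F_p[y_1,\dots,y_n]\subseteq H^*((B\mathbb Z/p)^n;\mathbb F_p)$ (for $p$ odd the Bockstein acts as zero). Let $d_{n,1},\dots,d_{n,n}\in D_n$ be the Dickson invariants, determined by $\prod_{v}(X-v)=\sum_{i=0}^n(-1)^i d_{n,i}X^{p^{n-i}}$ (with $d_{n,0}=1$), the product being over all linear forms $v$ in $y_1,\dots,y_n$ over $\mathbb F_p$; thus $|d_{n,i}|=2(p^n-p^{n-i})$, resp. $2^n-2^{n-i}$ if $p=2$. Let $\overline{D_n}\subset D_n$ be the augmentation ideal (the invariants without constant term). (1) Let $f:D_n\to D_n$ be an $\mathcal A$-linear map of degree $0$ with $f(d_{n,1})\ne 0$. Then $f$ restricts to an isomorphism $\overline{D_n}\to\overline{D_n}$; moreover, $f$ is an isomorphism of $D_n$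 if and only if $f(1)\neq 0$. (2) Hence the classical Dickson algebra is atomic, in the following sense: every degree-preserving $\mathcal A$-linear map $\overline{D_n}\to\overline{D_n}$ which is an isomorphism on the lowest positive degree in which $\overline{D_n}$ is nonzero is an isomorphism. -/

import Mathlib

open Polynomial

namespace Dickson

/-! ### The mod `p` Steenrod algebra -/

/-- Generators of the mod `p` Steenrod algebra: the Bockstein `β` and the operations `P^k`
(for `p = 2`, `P^k` is the Steenrod square `Sq^k`). -/
inductive SteenrodGen : Type
  | bockstein : SteenrodGen
  | power (k : ℕ) : SteenrodGen

/-- `β` in the free algebra. -/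
def freeBockstein (p : ℕ) : FreeAlgebra (ZMod p) SteenrodGen :=
  FreeAlgebra.ι (ZMod p) SteenrodGen.bockstein

/-- `P^k` in the free algebra. -/
def freePower (p k : ℕ) : FreeAlgebra (ZMod p) SteenrodGen :=
  FreeAlgebra.ι (ZMod p) (SteenrodGen.power k)

/-- The defining relations of the mod `p` Steenrod algebra: `P^0 = 1`, the Adem relations, and, for
odd `p`, `β² = 0` and the Adem relations with a Bockstein. For `p = 2` the relation `adem` reads
`Sq^a Sq^b = ∑ j, C(b-j-1, a-2j) Sq^(a+b-j) Sq^j` for `a < 2b`, and `β = Sq^1`. -/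
inductive SteenrodRel (p : ℕ) :
    FreeAlgebra (ZMod p) SteenrodGen → FreeAlgebra (ZMod p) SteenrodGen → Prop
  | power_zero : SteenrodRel p (freePower p 0) 1
  | adem (a b : ℕ) (hab : a < p * b) :
      SteenrodRel p (freePower p a * freePower p b)
        (∑ j ∈ Finset.range (a + 1) with p * j ≤ a,
          ((-1 : ZMod p) ^ (a + j) * (((p - 1) * (b - j) - 1).choose (a - p * j) : ZMod p)) •
            (freePower p (a + b - j) * freePower p j))
  | bockstein_sq (hp : p ≠ 2) : SteenrodRel p (freeBockstein p * freeBockstein p) 0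
  | adem_bockstein (hp : p ≠ 2) (a b : ℕ) (hab : a ≤ p * b) :
      SteenrodRel p (freePower p a * freeBockstein p * freePower p b)
        ((∑ j ∈ Finset.range (a + 1) with p * j ≤ a,
          ((-1 : ZMod p) ^ (a + j) * (((p - 1) * (b - j)).choose (a - p * j) : ZMod p)) •
            (freeBockstein p * freePower p (a + b - j) * freePower p j)) +
        ∑ j ∈ Finset.range (a + 1) with p * j + 1 ≤ a,
          ((-1 : ZMod p) ^ (a + j + 1) *
            (((p - 1) * (b - j) - 1).choose (a - p * j - 1) : ZMod p)) •
            (freePower p (a + b - j) * freeBockstein p * freePower p j))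
  | bockstein_two (hp : p = 2) : SteenrodRel p (freeBockstein p) (freePower p 1)

/-- The mod `p` Steenrod algebra `𝒜`. -/
abbrev SteenrodAlgebra (p : ℕ) : Type := RingQuot (SteenrodRel p)

/-! ### Reduced powers on polynomial algebras -/

section Powers

variable (p : ℕ) [Fact p.Prime] (σ : Type*)

/-- The total operation `∑ P^k t^k`: the algebra homomorphism with `y ↦ y + y^p t` on each
variable `y`. Multiplicativity is the Cartan formula. -/
noncomputable def totalPower :
    MvPolynomial σ (ZMod p) →ₐ[ZMod p] (MvPolynomial σ (ZMod p))[X] :=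
  MvPolynomial.aeval fun i => C (MvPolynomial.X i) + C (MvPolynomial.X i ^ p) * X

/-- The operation `P^k` (`Sq^k` if `p = 2`) on `𝔽_p[y_i : i ∈ σ]`. -/
noncomputable def steenrodPower (k : ℕ) : Module.End (ZMod p) (MvPolynomial σ (ZMod p)) where
  toFun f := (totalPower p σ f).coeff k
  map_add' f g := by simp
  map_smul' c f := by simp

/-- The Bockstein on `𝔽_p[y_i : i ∈ σ]`: it is `Sq^1` if `p = 2`, and it is zero if `p` is odd,
the `y_i` being of degree two and themselves Bocksteins. -/
noncomputable def bocksteinOp : Module.End (ZMod p) (MvPolynomial σ (ZMod p)) :=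
  if p = 2 then steenrodPower p σ 1 else 0

variable {p σ}

theorem coeff_eval₂_C_mul_X {A L : Type*} [CommRing A] [CommRing L] (ψ : A →+* L[X]) (v : L)
    (q : A[X]) (N : ℕ) :
    (eval₂ ψ (C v * X) q).coeff N =
      ∑ x ∈ Finset.HasAntidiagonal.antidiagonal N, (ψ (q.coeff x.2)).coeff x.1 * v ^ x.2 := by
  induction q using Polynomial.induction_on' with
  | add f g hf hg => simp [eval₂_add, hf, hg, add_mul, Finset.sum_add_distrib]
  | monomial m r =>
    rw [eval₂_monomial, mul_pow, ← C_pow, ← mul_assoc, coeff_mul_X_pow', coeff_mul_C]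
    split_ifs with h
    · rw [Finset.sum_eq_single (N - m, m)]
      · simp
      · rintro ⟨a, b⟩ hx hne
        have : m ≠ b := by
          rintro rfl
          apply hne
          simp only [Finset.HasAntidiagonal.mem_antidiagonal] at hx
          simp only [Prod.mk.injEq, and_true]
          omega
        simp [coeff_monomial, this]
      · intro hx
        exact absurd (by simp only [Finset.HasAntidiagonal.mem_antidiagonal]; omega) hx
    · symm
      apply Finset.sum_eq_zero
      rintro ⟨a, b⟩ hx
      have : m ≠ b := by
        rintro rfl
        simp only [Finset.HasAntidiagonal.mem_antidiagonal] at hx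
        omega
      simp [coeff_monomial, this]

/-- `T_x f = ∑ φ(P^k f) x^k`. -/
noncomputable def evalPower {S : Type*} [CommRing S] (φ : MvPolynomial σ (ZMod p) →+* S) (x : S) :
    MvPolynomial σ (ZMod p) →+* S :=
  (eval₂RingHom φ x).comp (totalPower p σ).toRingHom

theorem evalPower_X {S : Type*} [CommRing S] (φ : MvPolynomial σ (ZMod p) →+* S) (x : S) (i : σ) :
    evalPower φ x (MvPolynomial.X i) = φ (MvPolynomial.X i) + φ (MvPolynomial.X i) ^ p * x := by
  simp [evalPower, totalPower, eval₂_add, eval₂_mul, eval₂_pow]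

theorem evalPower_comm {S : Type*} [CommRing S] [CharP S p]
    (φ : MvPolynomial σ (ZMod p) →+* S) (x y x' y' : S) (h1 : x + y = x' + y')
    (h2 : x ^ p * y = x' ^ p * y') :
    evalPower (evalPower φ x) y = evalPower (evalPower φ x') y' := by
  apply MvPolynomial.ringHom_ext
  · intro r
    exact RingHom.congr_fun (RingHom.ext_zmod
      ((evalPower (evalPower φ x) y).comp MvPolynomial.C)
      ((evalPower (evalPower φ x') y').comp MvPolynomial.C)) r
  · intro i
    simp only [evalPower_X, add_pow_char, mul_pow]
    linear_combination (φ (MvPolynomial.X i)) ^ p * h1 +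
      ((φ (MvPolynomial.X i)) ^ p) ^ p * h2

theorem sum_steenrodPower {L : Type*} [CommRing L] [CharP L p]
    (φ : MvPolynomial σ (ZMod p) →+* L) (s u t : L) (h1 : s + 1 = u + t ^ p) (h2 : s = t * u)
    (f : MvPolynomial σ (ZMod p)) (N : ℕ) :
    ∑ x ∈ Finset.HasAntidiagonal.antidiagonal N,
        φ (steenrodPower p σ x.1 (steenrodPower p σ x.2 f)) * s ^ x.1 =
      ∑ x ∈ Finset.HasAntidiagonal.antidiagonal N,
        φ (steenrodPower p σ x.1 (steenrodPower p σ x.2 f)) * u ^ x.1 * (t ^ p) ^ x.2 := by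
  have key (x y : L) : (evalPower (evalPower ((C : L →+* L[X]).comp φ) (C x * X)) (C y * X) f).coeff
      N = ∑ z ∈ Finset.HasAntidiagonal.antidiagonal N,
        φ (steenrodPower p σ z.1 (steenrodPower p σ z.2 f)) * x ^ z.1 * y ^ z.2 := by
    have inner (g : MvPolynomial σ (ZMod p)) (a : ℕ) :
        (evalPower ((C : L →+* L[X]).comp φ) (C x * X) g).coeff a =
          φ (steenrodPower p σ a g) * x ^ a := by
      change (eval₂ ((C : L →+* L[X]).comp φ) (C x * X) (totalPower p σ g)).coeff a = _
      rw [coeff_eval₂_C_mul_X, Finset.sum_eq_single (0, a)]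
      · simp [steenrodPower]
      · rintro ⟨c, d⟩ hx hne
        have : c ≠ 0 := by
          rintro rfl
          apply hne
          simpa [Finset.HasAntidiagonal.mem_antidiagonal] using hx
        simp [coeff_C, this]
      · intro hx
        exact absurd (Finset.HasAntidiagonal.mem_antidiagonal.2 (zero_add a)) hx
    change (eval₂ (evalPower ((C : L →+* L[X]).comp φ) (C x * X)) (C y * X)
      (totalPower p σ f)).coeff N = _
    rw [coeff_eval₂_C_mul_X]
    exact Finset.sum_congr rfl fun z _ => by rw [inner]; rfl
  have e := evalPower_comm ((C : L →+* L[X]).comp φ) (C s * X) (C 1 * X) (C u * X) (C (t ^ p) * X)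
    (by rw [← add_mul, ← add_mul, ← C_add, ← C_add, h1])
    (by
      rw [mul_pow, mul_pow, h2]
      simp only [map_one, map_mul, C_pow, mul_pow]
      ring)
  have := congrArg (fun q => q.coeff N) (RingHom.congr_fun e f)
  simp only [key, one_pow, mul_one] at this
  exact this

theorem coeff_one_sub_pow {L : Type*} [CommRing L] (k m : ℕ) :
    PowerSeries.coeff m ((1 - PowerSeries.X : PowerSeries L) ^ k) = (-1) ^ m * (k.choose m : L) := by
  induction k generalizing m with
  | zero => cases m <;> simp [PowerSeries.coeff_one]
  | succ k ih =>
    rw [pow_succ, mul_sub, mul_one, map_sub, ih]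
    cases m with
    | zero => simp
    | succ m =>
      rw [PowerSeries.coeff_succ_mul_X, ih, Nat.choose_succ_succ]
      push_cast
      ring

theorem dvd_choose_mul (p r : ℕ) (hr : 0 < r) (hp : 0 < p) : p ∣ ((p - 1) * r + r).choose r := by
  obtain ⟨r, rfl⟩ : ∃ k, r = k + 1 := ⟨r - 1, by omega⟩
  obtain ⟨q, rfl⟩ : ∃ k, p = k + 1 := ⟨p - 1, by omega⟩
  have e : (q + 1 - 1) * (r + 1) + (r + 1) = (q * (r + 1) + r) + 1 := by simp; ring
  rw [e]
  have h := Nat.add_one_mul_choose_eq (q * (r + 1) + r) r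
  have h' : (r + 1) * ((q + 1) * (q * (r + 1) + r).choose r) =
      (r + 1) * (q * (r + 1) + r + 1).choose (r + 1) := by
    rw [mul_comm (r + 1) (Nat.choose _ _), ← h]; ring
  exact ⟨_, (Nat.eq_of_mul_eq_mul_left (Nat.succ_pos r) h').symm⟩

/-- The Adem relations hold on polynomial algebras. -/
theorem steenrodPower_adem (a b : ℕ) (hab : a < p * b) :
    steenrodPower p σ a * steenrodPower p σ b =
      ∑ j ∈ Finset.range (a + 1) with p * j ≤ a,
        ((-1 : ZMod p) ^ (a + j) * (((p - 1) * (b - j) - 1).choose (a - p * j) : ZMod p)) •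
          (steenrodPower p σ (a + b - j) * steenrodPower p σ j) := by
  have hp : p.Prime := Fact.out
  have hp2 := hp.two_le
  refine LinearMap.ext fun f => ?_
  have : CharP (MvPolynomial σ (ZMod p)) p := inferInstance
  have : CharP (PowerSeries (MvPolynomial σ (ZMod p))) p :=
    charP_of_injective_ringHom (f := (PowerSeries.C : (MvPolynomial σ (ZMod p)) →+* PowerSeries (MvPolynomial σ (ZMod p))))
      PowerSeries.C_injective p
  let t : PowerSeries (MvPolynomial σ (ZMod p)) := PowerSeries.X
  let q : PowerSeries (MvPolynomial σ (ZMod p)) := 1 - t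
  let v : PowerSeries (MvPolynomial σ (ZMod p)) := PowerSeries.mk 1
  have hvq : v * q = 1 := PowerSeries.mk_one_mul_one_sub_eq_one (MvPolynomial σ (ZMod p))
  have hqp : q ^ p = 1 - t ^ p := by simp [q, sub_pow_char]
  have hqp' : q ^ p = q ^ (p - 1) * q := by
    rw [← pow_succ, Nat.sub_add_cancel hp.one_le]
  have main := sum_steenrodPower (PowerSeries.C : (MvPolynomial σ (ZMod p)) →+* PowerSeries (MvPolynomial σ (ZMod p))) (t * q ^ (p - 1))
    (q ^ (p - 1)) t (by
      have : q ^ (p - 1) * q = 1 - t ^ p := by rw [← hqp', hqp]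
      have e : q = 1 - t := rfl
      rw [e] at this ⊢
      linear_combination -this) rfl f (a + b)
  have canc (m k : ℕ) (h : m ≤ k) : q ^ m * v ^ k = v ^ (k - m) := by
    obtain ⟨d, rfl⟩ := Nat.exists_eq_add_of_le h
    rw [pow_add, ← mul_assoc, ← mul_pow, mul_comm q v, hvq]
    simp
  have canc' (m k : ℕ) (h : k ≤ m) : q ^ m * v ^ k = q ^ (m - k) := by
    obtain ⟨d, rfl⟩ := Nat.exists_eq_add_of_le h
    rw [pow_add, mul_right_comm, ← mul_pow, mul_comm q v, hvq]
    simp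
  have main' := congrArg (fun z => PowerSeries.coeff a (z * v ^ ((p - 1) * a + 1))) main
  simp only [Finset.sum_mul, map_sum] at main'
  rw [Finset.sum_eq_single (a, b)] at main'
  rotate_left
  · rintro ⟨c, d⟩ hx hne
    simp only [Finset.HasAntidiagonal.mem_antidiagonal] at hx
    simp only
    rw [mul_assoc, PowerSeries.coeff_C_mul, mul_pow, mul_assoc, PowerSeries.coeff_X_pow_mul']
    split_ifs with hc
    · have hlt : c < a := by
        refine lt_of_le_of_ne hc ?_
        rintro rfl
        apply hne
        simp only [Prod.mk.injEq, true_and]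
        omega
      obtain ⟨r, rfl⟩ := Nat.exists_eq_add_of_le hc
      rw [← pow_mul, canc _ _ (by rw [mul_add]; omega)]
      have e : (p - 1) * (c + r) + 1 - (p - 1) * c = (p - 1) * r + 1 := by
        rw [mul_add]; omega
      rw [e]
      simp only [v]
      rw [PowerSeries.mk_one_pow_eq_mk_choose_add, PowerSeries.coeff_mk, Nat.add_sub_cancel_left,
        Nat.choose_symm_add, (CharP.cast_eq_zero_iff (MvPolynomial σ (ZMod p)) p _).2
          (dvd_choose_mul p r (by omega) hp.pos), mul_zero]
    · simp
  · intro hx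
    exact (hx (Finset.HasAntidiagonal.mem_antidiagonal.2 rfl)).elim
  have lhs : PowerSeries.coeff a (PowerSeries.C (steenrodPower p σ a (steenrodPower p σ b f)) *
      (t * q ^ (p - 1)) ^ a * v ^ ((p - 1) * a + 1)) =
      steenrodPower p σ a (steenrodPower p σ b f) := by
    rw [mul_assoc, PowerSeries.coeff_C_mul, mul_pow, mul_assoc, PowerSeries.coeff_X_pow_mul',
      if_pos le_rfl, ← pow_mul, canc _ _ (by omega)]
    simp [v]

  rw [lhs] at main'
  rw [Module.End.mul_apply, main', LinearMap.sum_apply]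
  rw [Finset.Nat.sum_antidiagonal_eq_sum_range_succ_mk, Finset.sum_filter,
    ← Finset.sum_range_reflect]
  have hrange : Finset.range (a + 1) ⊆ Finset.range (a + b).succ :=
    Finset.range_subset_range.2 (by omega)
  rw [← Finset.sum_subset hrange]
  · refine Finset.sum_congr rfl fun j hj => ?_
    rw [Finset.mem_range] at hj
    have e1 : (a + b).succ - 1 - j = a + b - j := by omega
    have e2 : a + b - (a + b - j) = j := by omega
    simp only [e1, e2]
    rw [mul_assoc, mul_assoc, PowerSeries.coeff_C_mul, mul_left_comm, ← pow_mul,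
      PowerSeries.coeff_X_pow_mul']
    split_ifs with hpj
    · have hjb : j < b := lt_of_mul_lt_mul_left (lt_of_le_of_lt hpj hab) (Nat.zero_le p)
      obtain ⟨d, rfl⟩ := Nat.exists_eq_add_of_lt hjb
      have hpd : 1 ≤ (p - 1) * (d + 1) := Nat.mul_pos (by omega) (by omega)
      have e3 : (p - 1) * (a + (j + d + 1) - j) = (p - 1) * a + (p - 1) * (d + 1) := by
        rw [← mul_add]; congr 1; omega
      have e4 : j + d + 1 - j = d + 1 := by omega
      rw [← pow_mul, e3, canc' _ _ (by omega), e4]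
      have e5 : (p - 1) * a + (p - 1) * (d + 1) - ((p - 1) * a + 1) = (p - 1) * (d + 1) - 1 := by
        omega
      rw [e5]
      simp only [q, t]
      rw [coeff_one_sub_pow]
      have sgn : ((-1 : ZMod p) ^ (a + j)) = (-1) ^ (a - p * j) := by
        rcases hp.eq_two_or_odd' with h2 | hodd
        · subst h2
          have : (-1 : ZMod 2) = 1 := CharTwo.neg_eq 1
          simp [this]
        · have e6 : a + j = (a - p * j) + (p * j + j) := by omega
          have : Even (p * j + j) := by
            have : p * j + j = (p + 1) * j := by ring
            rw [this]
            exact (hodd.add_one).mul_right j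
          rw [e6, pow_add, this.neg_one_pow, mul_one]
      rw [sgn, LinearMap.smul_apply, Module.End.mul_apply, Algebra.smul_def, mul_comm]
      simp
    · simp
  · intro j hj hj'
    simp only [Finset.mem_range] at hj hj'
    have e1 : (a + b).succ - 1 - j = a + b - j := by omega
    have e2 : a + b - (a + b - j) = j := by omega
    have hpj : ¬ p * j ≤ a := by
      have : 1 * j ≤ p * j := Nat.mul_le_mul_right j hp.one_le
      omega
    simp only [e1, e2]
    rw [mul_assoc, mul_assoc, PowerSeries.coeff_C_mul, mul_left_comm, ← pow_mul,
      PowerSeries.coeff_X_pow_mul', if_neg hpj, mul_zero]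

theorem steenrodPower_zero : steenrodPower p σ 0 = 1 := by
  have h : ((Polynomial.aeval (R := MvPolynomial σ (ZMod p)) 0).restrictScalars (ZMod p)).comp
      (totalPower p σ) = AlgHom.id (ZMod p) (MvPolynomial σ (ZMod p)) := by
    apply MvPolynomial.algHom_ext
    intro i
    simp [totalPower]
  refine LinearMap.ext fun f => ?_
  have := DFunLike.congr_fun h f
  simpa [steenrodPower, coeff_zero_eq_aeval_zero] using this

end Powers

/-! ### The action of the Steenrod algebra -/

section Action

variable (p : ℕ) [Fact p.Prime] (σ : Type*)

/-- The action of the generators on `𝔽_p[y_i : i ∈ σ]`. -/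
noncomputable def genOp : SteenrodGen → Module.End (ZMod p) (MvPolynomial σ (ZMod p))
  | SteenrodGen.bockstein => bocksteinOp p σ
  | SteenrodGen.power k => steenrodPower p σ k

/-- The action of the Steenrod algebra on `𝔽_p[y_i : i ∈ σ]`, as an algebra homomorphism. -/
noncomputable def steenrodAction :
    SteenrodAlgebra p →ₐ[ZMod p] Module.End (ZMod p) (MvPolynomial σ (ZMod p)) :=
  RingQuot.liftAlgHom (ZMod p) ⟨FreeAlgebra.lift (ZMod p) (genOp p σ), by
    intro x y h
    have hP (k : ℕ) : FreeAlgebra.lift (ZMod p) (genOp p σ) (freePower p k) =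
        steenrodPower p σ k := by simp [freePower, genOp]
    have hB : FreeAlgebra.lift (ZMod p) (genOp p σ) (freeBockstein p) = bocksteinOp p σ := by
      simp [freeBockstein, genOp]
    cases h with
    | power_zero => rw [hP, steenrodPower_zero, map_one]
    | adem a b hab =>
      simp only [map_mul, map_sum, map_smul, hP]
      exact steenrodPower_adem a b hab
    | bockstein_sq hp => simp [hB, bocksteinOp, hp]
    | adem_bockstein hp a b hab =>
      simp [hB, hP, bocksteinOp, hp]
    | bockstein_two hp => rw [hB, hP, bocksteinOp, if_pos hp]⟩

/-- `𝔽_p[y_i : i ∈ σ]` as a module over the Steenrod algebra. -/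
noncomputable instance : Module (SteenrodAlgebra p) (MvPolynomial σ (ZMod p)) :=
  Module.compHom _ (steenrodAction p σ).toRingHom

instance : IsScalarTower (ZMod p) (SteenrodAlgebra p) (MvPolynomial σ (ZMod p)) where
  smul_assoc c a f := by
    change steenrodAction p σ (c • a) f = c • steenrodAction p σ a f
    rw [map_smul, LinearMap.smul_apply]

variable {p σ}

/-- The class of `P^k` in the Steenrod algebra. -/
noncomputable def powerClass (p k : ℕ) : SteenrodAlgebra p :=
  RingQuot.mkAlgHom (ZMod p) (SteenrodRel p) (freePower p k)

theorem powerClass_smul (k : ℕ) (f : MvPolynomial σ (ZMod p)) :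
    powerClass p k • f = steenrodPower p σ k f := by
  change steenrodAction p σ (powerClass p k) f = _
  simp [steenrodAction, powerClass, freePower, genOp]

/-- A subspace stable under all `P^k` is stable under the Steenrod algebra. -/
theorem smul_mem_of_power_mem (N : Submodule (ZMod p) (MvPolynomial σ (ZMod p)))
    (h : ∀ k, ∀ f ∈ N, steenrodPower p σ k f ∈ N) (a : SteenrodAlgebra p)
    {f : MvPolynomial σ (ZMod p)} (hf : f ∈ N) : a • f ∈ N := by
  obtain ⟨x, rfl⟩ := RingQuot.mkAlgHom_surjective (ZMod p) (SteenrodRel p) a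
  change steenrodAction p σ (RingQuot.mkAlgHom (ZMod p) (SteenrodRel p) x) f ∈ N
  simp only [steenrodAction, RingQuot.liftAlgHom_mkAlgHom_apply]
  induction x using FreeAlgebra.induction generalizing f with
  | grade0 r =>
    rw [AlgHom.commutes, Module.algebraMap_end_apply]
    exact N.smul_mem r hf
  | grade1 g =>
    rw [FreeAlgebra.lift_ι_apply]
    cases g with
    | bockstein =>
      simp only [genOp, bocksteinOp]
      split_ifs
      · exact h 1 f hf
      · exact N.zero_mem
    | power k => exact h k f hf
  | mul x y hx hy =>
    rw [map_mul, Module.End.mul_apply]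
    exact hx (hy hf)
  | add x y hx hy =>
    rw [map_add, LinearMap.add_apply]
    exact N.add_mem (hx hf) (hy hf)

end Action

/-! ### Atomic graded modules -/

section Atomic

variable {k A M : Type*} [CommRing k] [Ring A] [AddCommGroup M] [Module k M] [Module A M]

/-- `f` is a module map of degree zero for the grading `𝓜` of `M`. -/
def IsDegreeZero (𝓜 : ℕ → Submodule k M) (f : M →ₗ[A] M) : Prop :=
  ∀ i, ∀ x ∈ 𝓜 i, f x ∈ 𝓜 i

variable (A) in
/-- The graded `A`-module `M`, with homogeneous components `𝓜 i`, is atomic: every `A`-linear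
self-map of degree zero which is an isomorphism on the lowest positive degree in which `M` does not
vanish is an isomorphism. -/
def IsAtomic (𝓜 : ℕ → Submodule k M) : Prop :=
  ∀ f : M →ₗ[A] M, IsDegreeZero 𝓜 f →
    ∀ r, IsLeast {i | 0 < i ∧ 𝓜 i ≠ ⊥} r → Set.BijOn f (𝓜 r) (𝓜 r) → Function.Bijective f

end Atomic

/-! ### The classical Dickson algebra -/

section Classical

variable (p : ℕ) [Fact p.Prime] (n : ℕ)

/-- The cohomological degree of the polynomial generators `y_i`. -/
def genDegree (p : ℕ) : ℕ := if p = 2 then 1 else 2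

/-- The action of a matrix `g` on `𝔽_p[y_1, …, y_n]` by linear substitution. -/
noncomputable def subst (g : Matrix (Fin n) (Fin n) (ZMod p)) :
    MvPolynomial (Fin n) (ZMod p) →ₐ[ZMod p] MvPolynomial (Fin n) (ZMod p) :=
  MvPolynomial.aeval fun j => ∑ i, g i j • MvPolynomial.X i

/-- The algebra of invariants `𝔽_p[y_1, …, y_n]^{GL_n}`. -/
noncomputable def invariants : Subalgebra (ZMod p) (MvPolynomial (Fin n) (ZMod p)) :=
  ⨅ g : GL (Fin n) (ZMod p), AlgHom.equalizer (subst p n g) (AlgHom.id (ZMod p) _)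

variable {p n} in
theorem mem_invariants {f : MvPolynomial (Fin n) (ZMod p)} :
    f ∈ invariants p n ↔ ∀ g : GL (Fin n) (ZMod p), subst p n g f = f := by
  simp [invariants, Algebra.mem_iInf, AlgHom.mem_equalizer]

variable {p n} in
theorem steenrodPower_subst (g : Matrix (Fin n) (Fin n) (ZMod p)) (k : ℕ)
    (f : MvPolynomial (Fin n) (ZMod p)) :
    steenrodPower p (Fin n) k (subst p n g f) = subst p n g (steenrodPower p (Fin n) k f) := by
  have h : (totalPower p (Fin n)).comp (subst p n g) =
      (Polynomial.mapAlgHom (subst p n g)).comp (totalPower p (Fin n)) := by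
    apply MvPolynomial.algHom_ext
    intro j
    simp [totalPower, subst, sum_pow_char, _root_.smul_pow, ZMod.pow_card, Finset.sum_add_distrib,
      Finset.sum_mul, map_sum, smul_add, ← Polynomial.smul_C]
  have := congrArg (fun q => q.coeff k) (DFunLike.congr_fun h f)
  simpa [steenrodPower] using this

/-- The classical Dickson algebra `D_n = 𝔽_p[y_1, …, y_n]^{GL_n}` as a module over the Steenrod
algebra. -/
noncomputable def dickson : Submodule (SteenrodAlgebra p) (MvPolynomial (Fin n) (ZMod p)) where
  carrier := invariants p n
  add_mem' := (invariants p n).add_mem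
  zero_mem' := (invariants p n).zero_mem
  smul_mem' a _ hf := smul_mem_of_power_mem (Subalgebra.toSubmodule (invariants p n))
    (fun k f hf => mem_invariants.2 fun g => by
      rw [← steenrodPower_subst, mem_invariants.1 hf g]) a hf

variable {p n} in
theorem constantCoeff_steenrodPower (k : ℕ) (f : MvPolynomial (Fin n) (ZMod p))
    (hf : MvPolynomial.constantCoeff f = 0) :
    MvPolynomial.constantCoeff (steenrodPower p (Fin n) k f) = 0 := by
  have hp : p ≠ 0 := (Fact.out : p.Prime).ne_zero
  have h : (Polynomial.mapRingHom MvPolynomial.constantCoeff).comp (totalPower p (Fin n)).toRingHom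
      = C.comp (MvPolynomial.constantCoeff (R := ZMod p) (σ := Fin n)) := by
    apply MvPolynomial.ringHom_ext
    · intro r
      exact RingHom.congr_fun (RingHom.ext_zmod
        (((Polynomial.mapRingHom MvPolynomial.constantCoeff).comp
          (totalPower p (Fin n)).toRingHom).comp MvPolynomial.C)
        ((C.comp (MvPolynomial.constantCoeff (R := ZMod p) (σ := Fin n))).comp MvPolynomial.C)) r
    · intro i
      simp [totalPower, hp]
  have := congrArg (fun q => q.coeff k) (DFunLike.congr_fun h f)
  simpa [steenrodPower, hf] using this

/-- The augmentation ideal of the classical Dickson algebra, that is the invariants without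
constant term, as a module over the Steenrod algebra. -/
noncomputable def augmentation :
    Submodule (SteenrodAlgebra p) (MvPolynomial (Fin n) (ZMod p)) where
  carrier := {f | f ∈ dickson p n ∧ MvPolynomial.constantCoeff f = 0}
  add_mem' hf hg := ⟨add_mem hf.1 hg.1, by rw [map_add, hf.2, hg.2, add_zero]⟩
  zero_mem' := ⟨zero_mem _, map_zero _⟩
  smul_mem' a f hf := by
    refine ⟨(dickson p n).smul_mem a hf.1, ?_⟩
    let N : Submodule (ZMod p) (MvPolynomial (Fin n) (ZMod p)) :=
      { carrier := {f | MvPolynomial.constantCoeff f = 0}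
        add_mem' := fun {f g} (hf : _ = _) (hg : _ = _) => by
          change MvPolynomial.constantCoeff (f + g) = 0
          rw [map_add, hf, hg, add_zero]
        zero_mem' := map_zero _
        smul_mem' := fun c f (hf : _ = _) => by
          change MvPolynomial.constantCoeff (c • f) = 0
          rw [MvPolynomial.smul_eq_C_mul, map_mul, hf, mul_zero] }
    exact smul_mem_of_power_mem N (fun k f hf => constantCoeff_steenrodPower k f hf) a hf.2

/-- The elements of cohomological degree `i` of a submodule of `𝔽_p[y_1, …, y_n]`. -/
noncomputable def component (N : Submodule (SteenrodAlgebra p) (MvPolynomial (Fin n) (ZMod p)))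
    (i : ℕ) : Submodule (ZMod p) N :=
  (MvPolynomial.weightedHomogeneousSubmodule (ZMod p) (fun _ : Fin n => genDegree p) i).comap
    (N.subtype.restrictScalars (ZMod p))

/-- The polynomial `∏ (X - v)` over all linear forms `v` in `y_1, …, y_n`. -/
noncomputable def orbitPolynomial : (MvPolynomial (Fin n) (ZMod p))[X] :=
  ∏ v : Fin n → ZMod p, (X - C (∑ i, v i • MvPolynomial.X i))

/-- The Dickson invariant `d_{n,i}`, of degree `2(p^n - p^{n-i})` (`2^n - 2^{n-i}` if `p = 2`):
`∏ (X - v) = ∑ (-1)^i d_{n,i} X^{p^{n-i}}`. -/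
noncomputable def dicksonInvariant (i : ℕ) : MvPolynomial (Fin n) (ZMod p) :=
  (-1) ^ i * (orbitPolynomial p n).coeff (p ^ (n - i))

variable {p n} in
theorem dicksonInvariant_mem (i : ℕ) : dicksonInvariant p n i ∈ dickson p n := by
  refine mem_invariants.2 fun g => ?_
  have hlin (v : Fin n → ZMod p) : subst p n g (∑ j, v j • MvPolynomial.X j) =
      ∑ i, ((g : Matrix (Fin n) (Fin n) (ZMod p)).mulVec v) i • MvPolynomial.X i := by
    simp only [subst, map_sum, map_smul, MvPolynomial.aeval_X, Finset.smul_sum, smul_smul,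
      Matrix.mulVec, dotProduct, Finset.sum_smul]
    rw [Finset.sum_comm]
    exact Finset.sum_congr rfl fun _ _ => Finset.sum_congr rfl fun _ _ => by rw [mul_comm]
  have hbij : Function.Bijective (g : Matrix (Fin n) (Fin n) (ZMod p)).mulVec :=
    Function.bijective_iff_has_inverse.2
      ⟨((g⁻¹ : GL (Fin n) (ZMod p)) : Matrix (Fin n) (Fin n) (ZMod p)).mulVec,
        fun v => by rw [Matrix.mulVec_mulVec, ← Units.val_mul]; simp,
        fun v => by rw [Matrix.mulVec_mulVec, ← Units.val_mul]; simp⟩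
  have h : (orbitPolynomial p n).map (subst p n g : _ →+* _) = orbitPolynomial p n := by
    rw [orbitPolynomial, Polynomial.map_prod]
    refine Fintype.prod_bijective _ hbij _ _ fun v => ?_
    rw [Polynomial.map_sub, Polynomial.map_X, Polynomial.map_C, ← hlin v]
    rfl
  have hc := congrArg (fun q => q.coeff (p ^ (n - i))) h
  simp only [Polynomial.coeff_map] at hc
  rw [dicksonInvariant, map_mul, map_pow, map_neg, map_one]
  exact congrArg _ hc

theorem one_mem_dickson : (1 : MvPolynomial (Fin n) (ZMod p)) ∈ dickson p n :=
  (invariants p n).one_mem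

end Classical

end Dickson

/-! Everything rests on one fact: any two nonzero homogeneous elements of the augmentation ideal
have a common nonzero multiple under the Steenrod algebra (`exists_smul_eq_smul`). A degree zero map
`f` killing a homogeneous `x ≠ 0` then also kills some `b • d ≠ 0`, where `d = d_{n,1}`. But `f d`
is a nonzero multiple of `d`, because the invariants in the degree of `d` form a line, and so `f (b
• d) ≠ 0`, a contradiction. Injectivity on the finite homogeneous pieces gives bijectivity. For
atomicity the line is not needed: a permutation of the finite lowest piece has finite order, so an
iterate of `f` fixes a nonzero `w` there, and `w` plays the role of `d`.

The common multiples are powers `Δ^(p-1)` of Moore determinants `Δ = det (y_i^(p^(E_l)))`: all those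
with large exponents lie in the submodule generated by `x` (`exists_mooreDet_pow_mem_span`). By
Milnor's description of the coaction, the coefficients of `x(∑ λ_J y^(p^J))`, as a polynomial in the
`λ_J`, lie in that submodule (`extendFunctional_aeval_additivePoly`). With `λ_J = ∑ r_l τ_l^(p^J)`,
suitably truncated, the substitution becomes `y_i ↦ ∑ r_l T_{l,i}`, where `T_{l,i} = ∑ (τ_l
y_i)^(p^J)` looks like a trace to `𝔽_p`: `T^p - T` telescopes to two terms, and neither affects the
coefficient of `∏ τ_l^((p-1) p^(E_l))` once the `E_l` are large. That coefficient therefore only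
sees the function on matrices over `𝔽_p` obtained by replacing `T` by `Y`
(`exists_coeff_aeval_traceSum_eq`).

It remains to produce the function `r · det(Y)^(p-1)` with `r ≠ 0`. Let `d` be minimal such that `x`
does not vanish on the first `d` coordinates. By invariance, `x` evaluated on combinations of `d`
vectors of `𝔽_p^n` depends only on whether these are independent, and vanishes if they are not
(`aeval_rowComb_eq_ite`). A counting argument modulo `p` over hyperplanes turns tests of
independence for `d` combinations of rows into the test for all `n` rows
(`exists_sum_rowsIndep_mul`). -/

namespace Dickson

/-! ### The Milnor coaction: substitution of additive polynomials -/

section Milnor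

variable {p : ℕ} [Fact p.Prime] {σ : Type*}

/-- The extension of scalars of a linear functional on `𝔽_p[y_i : i ∈ σ]`. -/
noncomputable def extendFunctional (R : Type*) [CommRing R] [Algebra (ZMod p) R]
    (ψ : MvPolynomial σ (ZMod p) →ₗ[ZMod p] ZMod p) : MvPolynomial σ R →ₗ[R] R :=
  (MvPolynomial.basisMonomials σ R).constr R fun m =>
    algebraMap (ZMod p) R (ψ (MvPolynomial.monomial m 1))

theorem extendFunctional_monomial {R : Type*} [CommRing R] [Algebra (ZMod p) R]
    (ψ : MvPolynomial σ (ZMod p) →ₗ[ZMod p] ZMod p) (m : σ →₀ ℕ) (r : R) :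
    extendFunctional R ψ (MvPolynomial.monomial m r) =
      r * algebraMap (ZMod p) R (ψ (MvPolynomial.monomial m 1)) := by
  have h : MvPolynomial.monomial m r = r • MvPolynomial.basisMonomials σ R m := by
    simp [MvPolynomial.smul_monomial]
  rw [h, map_smul, extendFunctional, Module.Basis.constr_basis, smul_eq_mul]

theorem extendFunctional_map_algebraMap {R : Type*} [CommRing R] [Algebra (ZMod p) R]
    (ψ : MvPolynomial σ (ZMod p) →ₗ[ZMod p] ZMod p) (x : MvPolynomial σ (ZMod p)) :
    extendFunctional R ψ (MvPolynomial.map (algebraMap (ZMod p) R) x) =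
      algebraMap (ZMod p) R (ψ x) := by
  induction x using MvPolynomial.induction_on' with
  | monomial m a =>
    have h : MvPolynomial.monomial m a = a • MvPolynomial.monomial m (1 : ZMod p) := by
      simp [MvPolynomial.smul_monomial]
    rw [MvPolynomial.map_monomial, extendFunctional_monomial, h, map_smul, smul_eq_mul, map_mul]
  | add f g hf hg => rw [map_add, map_add, hf, hg, map_add, map_add]

theorem extendFunctional_map {R S : Type*} [CommRing R] [Algebra (ZMod p) R] [CommRing S]
    [Algebra (ZMod p) S] (φ : R →ₐ[ZMod p] S)
    (ψ : MvPolynomial σ (ZMod p) →ₗ[ZMod p] ZMod p) (z : MvPolynomial σ R) :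
    extendFunctional S ψ (MvPolynomial.map (φ : R →+* S) z) = φ (extendFunctional R ψ z) := by
  induction z using MvPolynomial.induction_on' with
  | monomial m a =>
    rw [MvPolynomial.map_monomial, extendFunctional_monomial, extendFunctional_monomial, map_mul,
      AlgHom.commutes]
    rfl
  | add f g hf hg => rw [map_add, map_add, hf, hg, map_add, map_add]

theorem ringHom_ext_of_X {S : Type*} [CommRing S] {f g : MvPolynomial σ (ZMod p) →+* S}
    (h : ∀ i, f (MvPolynomial.X i) = g (MvPolynomial.X i)) : f = g :=
  MvPolynomial.ringHom_ext (fun r => RingHom.congr_fun (RingHom.ext_zmod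
    (f.comp MvPolynomial.C) (g.comp MvPolynomial.C)) r) h

/-- The additive polynomial `∑ λ_J y^(p^J)`, the sum being over `J < M`. -/
noncomputable def additivePoly (p : ℕ) {R : Type*} [CommRing R] (M : ℕ) (l : ℕ → R) (i : σ) :
    MvPolynomial σ R :=
  ∑ J ∈ Finset.range M, MvPolynomial.C (l J) * MvPolynomial.X i ^ p ^ J

/-- This is the total power operation with its parameter specialized to `a`. -/
theorem aeval_linear_eq_sum_steenrodPower {K : Type*} [Field K] [Algebra (ZMod p) K] (a : K)
    (x : MvPolynomial σ (ZMod p)) :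
    MvPolynomial.aeval (fun i => MvPolynomial.X i + MvPolynomial.C a * MvPolynomial.X i ^ p)
        (MvPolynomial.map (algebraMap (ZMod p) K) x) =
      ∑ k ∈ Finset.range ((totalPower p σ x).natDegree + 1),
        a ^ k • MvPolynomial.map (algebraMap (ZMod p) K) (steenrodPower p σ k x) := by
  have h : (eval₂RingHom (MvPolynomial.map (algebraMap (ZMod p) K)) (MvPolynomial.C a)).comp
      (totalPower p σ).toRingHom = ((MvPolynomial.aeval (R := K)
        (fun i : σ => MvPolynomial.X (R := K) i + MvPolynomial.C a * MvPolynomial.X i ^ p)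
        ).toRingHom).comp
        (MvPolynomial.map (algebraMap (ZMod p) K)) := by
    apply ringHom_ext_of_X
    intro i
    simp [totalPower, eval₂_add, eval₂_mul, eval₂_pow, mul_comm]
  have h' := RingHom.congr_fun h x
  change eval₂ _ _ (totalPower p σ x) = MvPolynomial.aeval _ _ at h'
  rw [← h', eval₂_eq_sum_range]
  refine Finset.sum_congr rfl fun k _ => ?_
  rw [MvPolynomial.smul_eq_C_mul, MvPolynomial.C_pow, mul_comm]
  rfl

/-- Since Frobenius is additive, composing `∑ l'_J y^(p^J)` with `y + a y^p` adds `l'_J a^(p^J)` to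
the coefficient of `y^(p^(J+1))`. The hypothesis `hM` says that the division by `y + a y^p` leaves
no remainder. -/
theorem aeval_additivePoly_comp {K : Type*} [Field K] [Algebra (ZMod p) K] (M : ℕ) (l l' : ℕ → K)
    (a : K) (h0 : l 0 = l' 0) (hs : ∀ J, l (J + 1) = l' (J + 1) + l' J * a ^ p ^ J)
    (hM : l' (M + 1) = 0) (z : MvPolynomial σ K) :
    MvPolynomial.aeval (additivePoly p (M + 2) l) z =
      MvPolynomial.aeval (fun i => MvPolynomial.X i + MvPolynomial.C a * MvPolynomial.X i ^ p)
        (MvPolynomial.aeval (additivePoly (σ := σ) p (M + 1) l') z) := by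
  have : CharP K p := charP_of_injective_algebraMap (algebraMap (ZMod p) K).injective p
  rw [← AlgHom.comp_apply, MvPolynomial.comp_aeval]
  congr 1
  apply congrArg
  funext i
  simp only [additivePoly, map_sum, map_mul, map_pow, MvPolynomial.aeval_X,
    MvPolynomial.algHom_C, MvPolynomial.algebraMap_eq, add_pow_char_pow, mul_add,
    Finset.sum_add_distrib]
  have e1 : ∑ J ∈ Finset.range (M + 1), MvPolynomial.C (l' J) * MvPolynomial.X (R := K) i ^ p ^ J =
      ∑ J ∈ Finset.range (M + 2), MvPolynomial.C (l' J) * MvPolynomial.X (R := K) i ^ p ^ J := by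
    rw [Finset.sum_range_succ _ (M + 1), hM]; simp
  rw [e1, Finset.sum_range_succ', Finset.sum_range_succ' _ (M + 1), h0, add_right_comm,
    ← Finset.sum_add_distrib]
  congr 1
  refine Finset.sum_congr rfl fun J _ => ?_
  rw [hs, map_add, map_mul, mul_pow, ← pow_mul, ← pow_succ', map_pow]
  ring

/-- Here `q J`, evaluated at `a`, is the coefficient `l'_J` of the quotient by `y + a y^p`. Positive
degree ensures that some `a` makes the remainder vanish over an algebraically closed field. -/
theorem natDegree_linear_factor_recursion {K : Type*} [Field K] {p : ℕ} (hp : 0 < p) (l : ℕ → K)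
    (q : ℕ → K[X]) (h0 : q 0 = 1) (hs : ∀ J, q (J + 1) = C (l (J + 1)) - q J * X ^ p ^ J) (J : ℕ) :
    q J ≠ 0 ∧ 0 < (q (J + 1)).natDegree := by
  have key (J : ℕ) (hJ : q J ≠ 0) : 0 < (q (J + 1)).natDegree := by
    have hd : (q J * X ^ p ^ J).natDegree = (q J).natDegree + p ^ J := by
      rw [natDegree_mul hJ (pow_ne_zero _ X_ne_zero), natDegree_X_pow]
    have hpos : 0 < p ^ J := pow_pos hp J
    rw [hs, natDegree_sub_eq_right_of_natDegree_lt (by rw [natDegree_C, hd]; omega), hd]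
    omega
  have nz : q J ≠ 0 := by
    induction J with
    | zero => rw [h0]; exact one_ne_zero
    | succ J ih => exact ne_zero_of_natDegree_gt (key J ih)
  exact ⟨nz, key J nz⟩

/-- Over an algebraically closed field, substituting `y + ∑ λ_J y^(p^J)` preserves the span of a
subspace stable under the operations `P^k`. -/
theorem aeval_additivePoly_mem_span {K : Type*} [Field K] [IsAlgClosed K] [Algebra (ZMod p) K]
    (N : Submodule (ZMod p) (MvPolynomial σ (ZMod p)))
    (hN : ∀ k, ∀ f ∈ N, steenrodPower p σ k f ∈ N) (M : ℕ) (l : ℕ → K) (hl : l 0 = 1)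
    (z : MvPolynomial σ K)
    (hz : z ∈ Submodule.span K (MvPolynomial.map (algebraMap (ZMod p) K) '' (N : Set _))) :
    MvPolynomial.aeval (additivePoly p (M + 1) l) z ∈
      Submodule.span K (MvPolynomial.map (algebraMap (ZMod p) K) '' (N : Set _)) := by
  induction M generalizing l z with
  | zero =>
    have : additivePoly (σ := σ) p (0 + 1) l = MvPolynomial.X := by
      funext i; simp [additivePoly, hl]
    rwa [this, MvPolynomial.aeval_X_left_apply]
  | succ M ih =>
    -- The coefficients of the quotient as polynomials in the unknown `a`; a root of `q (M + 1)`
    -- splits off one factor `y + a y^p`, and the remaining additive polynomial is one term shorter.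
    let q : ℕ → K[X] := fun J => Nat.rec 1 (fun J r => C (l (J + 1)) - r * X ^ p ^ J) J
    have hd := (natDegree_linear_factor_recursion (Fact.out : p.Prime).pos l q rfl
      (fun _ => rfl) M).2
    obtain ⟨a, ha⟩ := IsAlgClosed.exists_root (q (M + 1)) (natDegree_pos_iff_degree_pos.1 hd).ne'
    rw [aeval_additivePoly_comp M l (fun J => (q J).eval a) a (by simp [q, hl])
      (fun J => by
        have : q (J + 1) = C (l (J + 1)) - q J * X ^ p ^ J := rfl
        simp [this]) ha]
    have hz' := ih (fun J => (q J).eval a) (by simp [q]) z hz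
    generalize MvPolynomial.aeval (additivePoly (σ := σ) p (M + 1) fun J => (q J).eval a) z = w
      at hz'
    induction hz' using Submodule.span_induction with
    | mem w hw =>
      obtain ⟨x, hx, rfl⟩ := hw
      rw [aeval_linear_eq_sum_steenrodPower]
      exact Submodule.sum_mem _ fun k _ => Submodule.smul_mem _ _
        (Submodule.subset_span ⟨_, hN k x hx, rfl⟩)
    | zero => simp
    | add u v _ _ hu hv => rw [map_add]; exact add_mem hu hv
    | smul c u _ hu => rw [map_smul]; exact Submodule.smul_mem _ _ hu

theorem _root_.MvPolynomial.IsHomogeneous.aeval_mul {R B : Type*} [CommRing R] [CommRing B]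
    [Algebra R B] {f : MvPolynomial σ R} {m : ℕ} (hf : f.IsHomogeneous m) (c : B) (v : σ → B) :
    MvPolynomial.aeval (fun i => c * v i) f = c ^ m * MvPolynomial.aeval v f := by
  rw [MvPolynomial.aeval_def, MvPolynomial.aeval_def, MvPolynomial.eval₂_eq, MvPolynomial.eval₂_eq,
    Finset.mul_sum]
  refine Finset.sum_congr rfl fun d hd => ?_
  have h : ∑ i ∈ d.support, d i = m := by
    have := hf (MvPolynomial.mem_support_iff.1 hd)
    rw [← this, Finsupp.weight_apply, Finsupp.sum]
    simp
  simp only [mul_pow, Finset.prod_mul_distrib, Finset.prod_pow_eq_pow_sum, h]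
  ring

/-- Homogeneity of `x` allows the leading coefficient `l 0` to be scaled to `1`, after which the
additive polynomial is a composite of factors `y + a y^p`. Membership in `N` is expressed through
functionals vanishing on `N`, a form that survives changes of scalars. -/
theorem extendFunctional_aeval_additivePoly_of_isAlgClosed {K : Type*} [Field K] [IsAlgClosed K]
    [Algebra (ZMod p) K] (N : Submodule (ZMod p) (MvPolynomial σ (ZMod p)))
    (hN : ∀ k, ∀ f ∈ N, steenrodPower p σ k f ∈ N)
    (ψ : MvPolynomial σ (ZMod p) →ₗ[ZMod p] ZMod p) (hψ : ∀ f ∈ N, ψ f = 0)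
    {x : MvPolynomial σ (ZMod p)} (hx : x ∈ N) {m : ℕ} (hm : x.IsHomogeneous m) (M : ℕ)
    (l : ℕ → K) (h0 : l 0 ≠ 0) :
    extendFunctional K ψ (MvPolynomial.aeval (additivePoly p (M + 1) l) x) = 0 := by
  have e : (additivePoly p (M + 1) l : σ → MvPolynomial σ K) =
      fun i => MvPolynomial.C (l 0) * additivePoly p (M + 1) (fun J => l J / l 0) i := by
    funext i
    rw [additivePoly, additivePoly, Finset.mul_sum]
    refine Finset.sum_congr rfl fun J _ => ?_
    rw [← mul_assoc, ← MvPolynomial.C_mul, mul_div_cancel₀ _ h0]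
  have hmem := aeval_additivePoly_mem_span (K := K) N hN M (fun J => l J / l 0) (div_self h0)
    (MvPolynomial.map (algebraMap (ZMod p) K) x) (Submodule.subset_span ⟨x, hx, rfl⟩)
  have hle : Submodule.span K (MvPolynomial.map (algebraMap (ZMod p) K) '' (N : Set _)) ≤
      LinearMap.ker (extendFunctional K ψ) := by
    rw [Submodule.span_le]
    rintro _ ⟨f, hf, rfl⟩
    rw [SetLike.mem_coe, LinearMap.mem_ker, extendFunctional_map_algebraMap, hψ f hf, map_zero]
  have hzero := LinearMap.mem_ker.1 (hle hmem)
  rw [MvPolynomial.aeval_map_algebraMap] at hzero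
  rw [e, hm.aeval_mul, ← map_pow, ← MvPolynomial.smul_eq_C_mul, map_smul, hzero, smul_zero]

theorem extendFunctional_aeval_additivePoly_algHom {R S : Type*} [CommRing R] [Algebra (ZMod p) R]
    [CommRing S] [Algebra (ZMod p) S] (ψ : MvPolynomial σ (ZMod p) →ₗ[ZMod p] ZMod p)
    (x : MvPolynomial σ (ZMod p)) (M : ℕ) (φ : R →ₐ[ZMod p] S) (l : ℕ → R) :
    extendFunctional S ψ (MvPolynomial.aeval (additivePoly p M fun J => φ (l J)) x) =
      φ (extendFunctional R ψ (MvPolynomial.aeval (additivePoly p M l) x)) := by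
  rw [← extendFunctional_map]
  congr 1
  have h : ((MvPolynomial.aeval (additivePoly p M fun J => φ (l J))).toRingHom :
      MvPolynomial σ (ZMod p) →+* MvPolynomial σ S) =
      (MvPolynomial.map (φ : R →+* S)).comp (MvPolynomial.aeval (additivePoly p M l)).toRingHom :=
    ringHom_ext_of_X fun i => by simp [additivePoly]
  exact RingHom.congr_fun h x

/-- The coefficients of `x(∑ λ_J y^(p^J))` belong to every subspace which contains the homogeneous
element `x` and is stable under the operations `P^k`. -/
theorem extendFunctional_aeval_additivePoly {R : Type*} [CommRing R] [Algebra (ZMod p) R]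
    (N : Submodule (ZMod p) (MvPolynomial σ (ZMod p)))
    (hN : ∀ k, ∀ f ∈ N, steenrodPower p σ k f ∈ N)
    (ψ : MvPolynomial σ (ZMod p) →ₗ[ZMod p] ZMod p) (hψ : ∀ f ∈ N, ψ f = 0)
    {x : MvPolynomial σ (ZMod p)} (hx : x ∈ N) {m : ℕ} (hm : x.IsHomogeneous m) (M : ℕ)
    (l : ℕ → R) :
    extendFunctional R ψ (MvPolynomial.aeval (additivePoly p (M + 1) l) x) = 0 := by
  -- The universal case: the `λ_J` are independent variables, seen inside an algebraically closed
  -- field. The identity descends by injectivity to the polynomial ring and then specializes to any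
  -- `l`.
  let ι : MvPolynomial ℕ (ZMod p) →ₐ[ZMod p]
      AlgebraicClosure (FractionRing (MvPolynomial ℕ (ZMod p))) :=
    IsScalarTower.toAlgHom (ZMod p) (MvPolynomial ℕ (ZMod p)) _
  have hι : Function.Injective ι := by
    have e : (ι : MvPolynomial ℕ (ZMod p) → _) = algebraMap (FractionRing (MvPolynomial ℕ (ZMod p)))
        (AlgebraicClosure (FractionRing (MvPolynomial ℕ (ZMod p)))) ∘ algebraMap _ _ := by
      funext z
      exact IsScalarTower.algebraMap_apply _ _ _ z
    rw [e]
    exact (RingHom.injective (algebraMap (FractionRing (MvPolynomial ℕ (ZMod p))) _)).comp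
      (IsFractionRing.injective (MvPolynomial ℕ (ZMod p)) _)
  have h := extendFunctional_aeval_additivePoly_of_isAlgClosed N hN ψ hψ hx hm M
    (fun J => ι (MvPolynomial.X J)) (by
      rw [Ne, map_eq_zero_iff ι hι]; exact MvPolynomial.X_ne_zero 0)
  rw [extendFunctional_aeval_additivePoly_algHom, map_eq_zero_iff ι hι] at h
  have h' := extendFunctional_aeval_additivePoly_algHom ψ x (M + 1)
    (MvPolynomial.aeval l : MvPolynomial ℕ (ZMod p) →ₐ[ZMod p] R) MvPolynomial.X
  rw [h, map_zero] at h'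
  simpa using h'

end Milnor

/-! ### Coefficients of polynomials in truncated traces -/

section Coefficients

variable {p : ℕ}

/-- By Legendre's formula `(p - 1) v_p(a!)` is `a` minus its digit sum, so the claim is the
divisibility of `(a + b)!` by `a! b!`. -/
theorem digits_sum_add_le [Fact p.Prime] (a b : ℕ) :
    (p.digits (a + b)).sum ≤ (p.digits a).sum + (p.digits b).sum := by
  have ha := sub_one_mul_padicValNat_factorial (p := p) a
  have hb := sub_one_mul_padicValNat_factorial (p := p) b
  have hab := sub_one_mul_padicValNat_factorial (p := p) (a + b)
  have hle : padicValNat p a.factorial + padicValNat p b.factorial ≤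
      padicValNat p (a + b).factorial := by
    rw [← padicValNat.mul a.factorial_ne_zero b.factorial_ne_zero]
    exact (padicValNat_dvd_iff_le (a + b).factorial_ne_zero).1
      (pow_padicValNat_dvd.trans (Nat.factorial_mul_factorial_dvd_factorial_add a b))
  have h := Nat.mul_le_mul_left (p - 1) hle
  rw [mul_add, ha, hb, hab] at h
  have h1 := Nat.digit_sum_le p a
  have h2 := Nat.digit_sum_le p b
  have h3 := Nat.digit_sum_le p (a + b)
  omega

theorem digits_sum_pow_le [Fact p.Prime] (J : ℕ) : (p.digits (p ^ J)).sum ≤ 1 := by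
  have hp : p.Prime := Fact.out
  induction J with
  | zero => exact Nat.digit_sum_le p 1
  | succ J ih =>
    have := Nat.digits_add p hp.one_lt 0 (p ^ J) hp.pos (Or.inr (pow_pos hp.pos J).ne')
    rw [zero_add, ← pow_succ'] at this
    rw [this]
    simpa using ih

/-- The lowest `e` digits of `a p^e - 1` all equal `p - 1 ≥ 1`. -/
theorem le_digits_sum_mul_pow_sub_one [Fact p.Prime] {a : ℕ} (ha : 0 < a) (e : ℕ) :
    e ≤ (p.digits (a * p ^ e - 1)).sum := by
  have hp : p.Prime := Fact.out
  have hp2 := hp.two_le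
  induction e with
  | zero => exact Nat.zero_le _
  | succ e ih =>
    have hpos : 0 < a * p ^ e := Nat.mul_pos ha (pow_pos hp.pos e)
    have e1 : a * p ^ (e + 1) - 1 = (p - 1) + p * (a * p ^ e - 1) := by
      rw [pow_succ, ← mul_assoc, Nat.mul_sub, mul_one, mul_comm p]
      have : 1 * p ≤ a * p ^ e * p := Nat.mul_le_mul_right p hpos
      omega
    rw [e1, Nat.digits_add p hp.one_lt _ _ (by omega) (Or.inl (by omega)), List.sum_cons]
    omega

/-- All exponents of the variable `l` in `z` have base `p` digit sum at most `D`. -/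
def DigitBounded (p : ℕ) {ι S : Type*} [CommRing S] (l : ι) (D : ℕ) (z : MvPolynomial ι S) :
    Prop :=
  ∀ k, MvPolynomial.coeff k z ≠ 0 → (p.digits (k l)).sum ≤ D

namespace DigitBounded

variable {ι S : Type*} [CommRing S] {l : ι} {D D' : ℕ} {z z' : MvPolynomial ι S}

theorem mono (h : DigitBounded p l D z) (hD : D ≤ D') : DigitBounded p l D' z :=
  fun k hk => (h k hk).trans hD

theorem sum {α : Type*} {s : Finset α} {f : α → MvPolynomial ι S}
    (h : ∀ a ∈ s, DigitBounded p l D (f a)) : DigitBounded p l D (∑ a ∈ s, f a) := by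
  intro k hk
  rw [MvPolynomial.coeff_sum] at hk
  obtain ⟨a, ha, hne⟩ := Finset.exists_ne_zero_of_sum_ne_zero hk
  exact h a ha k hne

theorem mul [Fact p.Prime] (h : DigitBounded p l D z) (h' : DigitBounded p l D' z') :
    DigitBounded p l (D + D') (z * z') := by
  classical
  intro k hk
  rw [MvPolynomial.coeff_mul] at hk
  obtain ⟨⟨a, b⟩, hab, hne⟩ := Finset.exists_ne_zero_of_sum_ne_zero hk
  rw [← Finset.HasAntidiagonal.mem_antidiagonal.1 hab, Finsupp.add_apply]
  exact (digits_sum_add_le _ _).trans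
    (add_le_add (h a (left_ne_zero_of_mul hne)) (h' b (right_ne_zero_of_mul hne)))

theorem monomial {k : ι →₀ ℕ} (hk : (p.digits (k l)).sum ≤ D) (s : S) :
    DigitBounded p l D (MvPolynomial.monomial k s) := by
  classical
  intro k' hk'
  rw [MvPolynomial.coeff_monomial] at hk'
  split_ifs at hk' with h
  · rwa [← h]
  · exact absurd rfl hk'

theorem C (s : S) : DigitBounded p l 0 (MvPolynomial.C s : MvPolynomial ι S) :=
  monomial (by simp) s

theorem pow [Fact p.Prime] (h : DigitBounded p l D z) (m : ℕ) :
    DigitBounded p l (m * D) (z ^ m) := by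
  induction m with
  | zero => simpa using C (p := p) (l := l) (1 : S)
  | succ m ih => rw [pow_succ, add_mul, one_mul]; exact ih.mul h

theorem prod [Fact p.Prime] {α : Type*} {s : Finset α} {f : α → MvPolynomial ι S} {D : α → ℕ}
    (h : ∀ a ∈ s, DigitBounded p l (D a) (f a)) :
    DigitBounded p l (∑ a ∈ s, D a) (∏ a ∈ s, f a) := by
  classical
  induction s using Finset.induction_on with
  | empty => simpa using C (p := p) (l := l) (1 : S)
  | insert a s ha ih =>
    rw [Finset.prod_insert ha, Finset.sum_insert ha]
    exact (h a (Finset.mem_insert_self a s)).mul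
      (ih fun b hb => h b (Finset.mem_insert_of_mem hb))

/-- A monomial of degree `e` becomes a product of `e` factors of digit bound `1`, and digit sums are
subadditive. -/
theorem aeval [Fact p.Prime] {κ A : Type*} [CommRing A] [Algebra A S] {Y : κ → MvPolynomial ι S}
    (hY : ∀ i, DigitBounded p l 1 (Y i)) (h : MvPolynomial κ A) :
    DigitBounded p l h.totalDegree (MvPolynomial.aeval Y h) := by
  rw [MvPolynomial.aeval_def, MvPolynomial.eval₂_eq]
  refine sum fun d hd => ?_
  have h1 : DigitBounded p l (∑ i ∈ d.support, d i) (∏ i ∈ d.support, Y i ^ d i) :=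
    prod fun i _ => by simpa using (hY i).pow (d i)
  have h2 := (C (p := p) (l := l) (algebraMap A S (MvPolynomial.coeff d h))).mul h1
  rw [zero_add] at h2
  exact h2.mono (MvPolynomial.le_totalDegree hd)

end DigitBounded

/-- All exponents in `z` are at most `b`, and `c` is the coefficient at `b`. -/
def HasTop {ι S : Type*} [CommRing S] (z : MvPolynomial ι S) (b : ι →₀ ℕ) (c : S) : Prop :=
  (∀ k, MvPolynomial.coeff k z ≠ 0 → k ≤ b) ∧ MvPolynomial.coeff b z = c

namespace HasTop

variable {ι S : Type*} [CommRing S] {z z' : MvPolynomial ι S} {b b' : ι →₀ ℕ} {c c' : S}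

theorem mul (h : HasTop z b c) (h' : HasTop z' b' c') : HasTop (z * z') (b + b') (c * c') := by
  classical
  refine ⟨fun k hk => ?_, ?_⟩
  · rw [MvPolynomial.coeff_mul] at hk
    obtain ⟨⟨a, a'⟩, haa, hne⟩ := Finset.exists_ne_zero_of_sum_ne_zero hk
    rw [← Finset.HasAntidiagonal.mem_antidiagonal.1 haa]
    exact add_le_add (h.1 a (left_ne_zero_of_mul hne)) (h'.1 a' (right_ne_zero_of_mul hne))
  · rw [MvPolynomial.coeff_mul, Finset.sum_eq_single (b, b'), h.2, h'.2]
    · rintro ⟨a, a'⟩ haa hne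
      rw [Finset.HasAntidiagonal.mem_antidiagonal] at haa
      simp only at haa ⊢
      by_contra hne'
      have h1 := h.1 a (left_ne_zero_of_mul hne')
      have h2 := h'.1 a' (right_ne_zero_of_mul hne')
      apply hne
      have e1 : a = b := le_antisymm h1 (by
        have : a + a' ≤ a + b' := add_le_add le_rfl h2
        rw [haa] at this
        exact le_of_add_le_add_right this)
      subst e1
      rw [add_left_cancel haa]
    · intro hb
      exact absurd (Finset.HasAntidiagonal.mem_antidiagonal.2 (Eq.refl (b + b'))) hb

theorem one : HasTop (1 : MvPolynomial ι S) 0 1 := by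
  classical
  refine ⟨fun k hk => ?_, MvPolynomial.coeff_zero_one⟩
  rw [MvPolynomial.coeff_one] at hk
  split_ifs at hk with h
  · exact h.symm.le
  · exact absurd rfl hk

theorem pow (h : HasTop z b c) (m : ℕ) : HasTop (z ^ m) (m • b) (c ^ m) := by
  induction m with
  | zero => simpa using one
  | succ m ih => rw [pow_succ, pow_succ, succ_nsmul]; exact ih.mul h

theorem prod {α : Type*} {s : Finset α} {f : α → MvPolynomial ι S} {b : α → ι →₀ ℕ} {c : α → S}
    (h : ∀ a ∈ s, HasTop (f a) (b a) (c a)) :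
    HasTop (∏ a ∈ s, f a) (∑ a ∈ s, b a) (∏ a ∈ s, c a) := by
  classical
  induction s using Finset.induction_on with
  | empty => simpa using one
  | insert a s ha ih =>
    rw [Finset.prod_insert ha, Finset.sum_insert ha, Finset.prod_insert ha]
    exact (h a (Finset.mem_insert_self a s)).mul
      (ih fun b hb => h b (Finset.mem_insert_of_mem hb))

theorem sum {α : Type*} {s : Finset α} {f : α → MvPolynomial ι S} {c : α → S}
    (h : ∀ a ∈ s, HasTop (f a) b (c a)) : HasTop (∑ a ∈ s, f a) b (∑ a ∈ s, c a) := by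
  refine ⟨fun k hk => ?_, ?_⟩
  · rw [MvPolynomial.coeff_sum] at hk
    obtain ⟨a, ha, hne⟩ := Finset.exists_ne_zero_of_sum_ne_zero hk
    exact (h a ha).1 k hne
  · rw [MvPolynomial.coeff_sum]
    exact Finset.sum_congr rfl fun a ha => (h a ha).2

theorem units_smul (h : HasTop z b c) (u : ℤˣ) : HasTop (u • z) b (u • c) := by
  rcases Int.units_eq_one_or u with rfl | rfl
  · simpa using h
  · refine ⟨fun k hk => h.1 k fun h0 => hk ?_, ?_⟩
    · simp [h0]
    · simp [h.2]

/-- All entries of row `i` have the same top exponent `b i`, so every term of the Leibniz expansion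
has top exponent `∑ b i`. -/
theorem det [Fintype ι] [DecidableEq ι] {Y : Matrix ι ι (MvPolynomial ι S)} {b : ι → ι →₀ ℕ}
    {c : Matrix ι ι S} (h : ∀ i j, HasTop (Y i j) (b i) (c i j)) :
    HasTop Y.det (∑ i, b i) c.det := by
  rw [Matrix.det_apply, Matrix.det_apply]
  refine sum fun τ _ => units_smul ?_ _
  rw [← Equiv.sum_comp τ b]
  exact prod fun i _ => h (τ i) i

end HasTop

/-- `∑ (τ_l v)^(p^J)`, the sum being over `J ≤ N`. -/
noncomputable def traceSum (p : ℕ) {ι S : Type*} [CommRing S] (N : ℕ) (l : ι) (v : S) :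
    MvPolynomial ι S :=
  ∑ J ∈ Finset.range (N + 1), MvPolynomial.X l ^ p ^ J * MvPolynomial.C (v ^ p ^ J)

section Trace

variable [Fact p.Prime] {ι S : Type*} [CommRing S]

theorem traceSum_digitBounded (N : ℕ) (l l' : ι) (v : S) :
    DigitBounded p l' 1 (traceSum p N l v) := by
  classical
  refine DigitBounded.sum fun J _ => ?_
  refine DigitBounded.mul (D' := 0) ?_ (DigitBounded.C _)
  rw [MvPolynomial.X_pow_eq_monomial]
  refine DigitBounded.monomial ?_ _
  rw [Finsupp.single_apply]
  split_ifs
  · exact digits_sum_pow_le J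
  · simp

theorem traceSum_hasTop (N : ℕ) (l : ι) (v : S) :
    HasTop (traceSum p N l v) (Finsupp.single l (p ^ N)) (v ^ p ^ N) := by
  classical
  have hp : p.Prime := Fact.out
  have e (k : ι →₀ ℕ) : MvPolynomial.coeff k (traceSum p N l v) =
      ∑ J ∈ Finset.range (N + 1), if Finsupp.single l (p ^ J) = k then v ^ p ^ J else 0 := by
    rw [traceSum, MvPolynomial.coeff_sum]
    refine Finset.sum_congr rfl fun J _ => ?_
    rw [mul_comm, MvPolynomial.coeff_C_mul, MvPolynomial.coeff_X_pow]
    split_ifs <;> simp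
  refine ⟨fun k hk => ?_, ?_⟩
  · rw [e] at hk
    obtain ⟨J, hJ, hne⟩ := Finset.exists_ne_zero_of_sum_ne_zero hk
    split_ifs at hne with h
    · rw [← h, Finsupp.single_le_iff, Finsupp.single_eq_same]
      exact Nat.pow_le_pow_right hp.pos (by simpa [Nat.lt_succ_iff] using hJ)
    · exact absurd rfl hne
  · rw [e, Finset.sum_eq_single N]
    · simp
    · intro J _ hne
      rw [if_neg]
      intro h
      exact hne (Nat.pow_right_injective hp.two_le (Finsupp.single_injective l h))
    · simp

/-- Frobenius shifts the summands by one place and the difference telescopes. Up to the two end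
terms, the sum satisfies the equation `T^p = T` of `𝔽_p`. -/
theorem traceSum_pow_sub [CharP S p] (N : ℕ) (l : ι) (v : S) :
    traceSum p N l v ^ p - traceSum p N l v =
      MvPolynomial.X l ^ p ^ (N + 1) * MvPolynomial.C (v ^ p ^ (N + 1)) -
        MvPolynomial.X l * MvPolynomial.C v := by
  have e : traceSum p N l v ^ p = ∑ J ∈ Finset.range (N + 1),
      MvPolynomial.X l ^ p ^ (J + 1) * MvPolynomial.C (v ^ p ^ (J + 1)) := by
    rw [traceSum, sum_pow_char]
    refine Finset.sum_congr rfl fun J _ => ?_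
    rw [mul_pow, ← pow_mul, ← map_pow, ← pow_mul, ← pow_succ]
  rw [e, traceSum, ← Finset.sum_sub_distrib, Finset.sum_range_sub
    (fun J => MvPolynomial.X (R := S) l ^ p ^ J * MvPolynomial.C (v ^ p ^ J))]
  simp

end Trace

theorem prod_X_sub_C_eq [Fact p.Prime] (A : Type*) [CommRing A] [Algebra (ZMod p) A]
    {κ : Type*} (i : κ) :
    ∏ a : ZMod p, (MvPolynomial.X i - MvPolynomial.C (algebraMap (ZMod p) A a)) =
      MvPolynomial.X (R := A) i ^ p - MvPolynomial.X i := by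
  have hp : p.Prime := Fact.out
  have h : ∏ a : ZMod p, (X - C a) = (X ^ p - X : (ZMod p)[X]) := by
    have hr := FiniteField.roots_X_pow_card_sub_X (ZMod p)
    rw [ZMod.card] at hr
    have hm : (X ^ p - X : (ZMod p)[X]).Monic :=
      monic_X_pow_sub (by rw [degree_X]; exact_mod_cast hp.one_lt)
    have := prod_multiset_X_sub_C_of_monic_of_roots_card_eq hm (by
      rw [hr, FiniteField.X_pow_card_sub_X_natDegree_eq _ hp.one_lt]
      simp [ZMod.card])
    rw [hr] at this
    exact this
  have := congrArg (aeval (MvPolynomial.X i : MvPolynomial κ A)) h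
  simpa [map_prod, IsScalarTower.algebraMap_apply (ZMod p) A (MvPolynomial κ A)] using this

/-- Combinatorial Nullstellensatz on the grid `𝔽_p^κ`, with `∏ (X_i - a) = X_i^p - X_i`. -/
theorem exists_eq_sum_mul_pow_sub [Fact p.Prime] {κ A : Type*} [Finite κ] [CommRing A]
    [IsDomain A] [Algebra (ZMod p) A] (f : MvPolynomial κ A)
    (hf : ∀ Y : κ → ZMod p, MvPolynomial.eval (fun i => algebraMap (ZMod p) A (Y i)) f = 0) :
    ∃ h : κ →₀ MvPolynomial κ A,
      f = ∑ i ∈ h.support, h i * (MvPolynomial.X i ^ p - MvPolynomial.X i) := by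
  classical
  obtain ⟨h, -, hh⟩ := MvPolynomial.combinatorial_nullstellensatz_exists_linearCombination
    (fun _ : κ => Finset.univ.image (algebraMap (ZMod p) A)) (fun _ => by simp) f (by
      intro x hx
      choose Y hY using fun i => (Finset.mem_image.1 (hx i))
      rw [← hf Y]
      congr 1
      exact congrArg _ (funext fun i => (hY i).2.symm))
  have hprod (i : κ) : ∏ r ∈ Finset.univ.image (algebraMap (ZMod p) A),
      (MvPolynomial.X i - MvPolynomial.C r) = MvPolynomial.X i ^ p - MvPolynomial.X i := by
    rw [Finset.prod_image fun a _ b _ hab => (algebraMap (ZMod p) A).injective hab,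
      prod_X_sub_C_eq]
  simp only [hprod, Finsupp.linearCombination_apply, Finsupp.sum, smul_eq_mul] at hh
  exact ⟨h, hh⟩

/-- Of the two end terms of `T^p - T`, the first has exponent `p^(N+1)`, which exceeds `(p-1) p^N`.
The second would need the exponent `(p-1) p^N - 1` in `w`, whose digit sum is at least `N > D`. -/
theorem coeff_mul_traceSum_pow_sub [Fact p.Prime] {ι S : Type*} [CommRing S] [CharP S p] {D N : ℕ}
    {l : ι} {w : MvPolynomial ι S} (hw : DigitBounded p l D w) (v : S) (hN : D < N) {b : ι →₀ ℕ}
    (hbl : b l = (p - 1) * p ^ N) :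
    MvPolynomial.coeff b (w * (traceSum p N l v ^ p - traceSum p N l v)) = 0 := by
  classical
  have hp : p.Prime := Fact.out
  have hp2 := hp.two_le
  have hpN : 0 < p ^ N := pow_pos hp.pos _
  have t1 : MvPolynomial.coeff b (w * (MvPolynomial.X l ^ p ^ (N + 1) *
      MvPolynomial.C (v ^ p ^ (N + 1)))) = 0 := by
    rw [mul_left_comm, MvPolynomial.X_pow_eq_monomial, MvPolynomial.coeff_monomial_mul', if_neg]
    rw [Finsupp.single_le_iff, hbl, pow_succ', not_le]
    exact Nat.mul_lt_mul_of_pos_right (by omega) hpN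
  have t2 : MvPolynomial.coeff b (w * (MvPolynomial.X l * MvPolynomial.C v)) = 0 := by
    have hmem : l ∈ b.support := by
      rw [Finsupp.mem_support_iff, hbl]
      exact (Nat.mul_pos (by omega) hpN).ne'
    rw [mul_left_comm, MvPolynomial.coeff_X_mul', if_pos hmem, mul_comm,
      MvPolynomial.coeff_C_mul]
    by_contra hne
    have h1 := hw _ (right_ne_zero_of_mul hne)
    rw [Finsupp.tsub_apply, hbl, Finsupp.single_eq_same] at h1
    have h2 := le_digits_sum_mul_pow_sub_one (p := p) (a := p - 1) (by omega) N
    omega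
  rw [traceSum_pow_sub, mul_sub, MvPolynomial.coeff_sub, t1, t2, sub_zero]

theorem nsmul_sum_single_apply {ι : Type*} [Fintype ι] (c : ℕ) (N : ι → ℕ) (l : ι) :
    (c • ∑ l, Finsupp.single l (N l)) l = c * N l := by
  classical
  rw [Finsupp.smul_apply, Finsupp.finsetSum_apply, Finset.sum_eq_single l]
  · rw [Finsupp.single_eq_same, smul_eq_mul]
  · intro b _ hb
    rw [Finsupp.single_apply, if_neg hb]
  · simp

theorem algHom_det_X {ι A B : Type*} [Fintype ι] [DecidableEq ι] [CommRing A] [CommRing B]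
    (φ : MvPolynomial (ι × ι) A →+* B) :
    φ (Matrix.of fun l i => MvPolynomial.X (l, i)).det =
      (Matrix.of fun l i => φ (MvPolynomial.X (l, i))).det := by
  rw [RingHom.map_det]
  rfl

theorem aeval_traceSum_digitBounded [Fact p.Prime] {ι A S : Type*} [CommRing A] [CommRing S]
    [Algebra A S] (h : MvPolynomial (ι × ι) A) (N : ι → ℕ) (y : ι → S) (l : ι) :
    DigitBounded p l h.totalDegree
      (MvPolynomial.aeval (fun i : ι × ι => traceSum p (N i.1) i.1 (y i.2)) h) := by
  refine DigitBounded.aeval ?_ h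
  intro i
  exact traceSum_digitBounded (N i.1) i.1 l (y i.2)

/-- A polynomial in the entries of a matrix which vanishes on singular matrices over `𝔽_p`
and is constant on invertible ones has a power of a Moore determinant among its coefficients
after substituting `∑ (τ_l y_i)^(p^J)` for the entries. -/
theorem exists_coeff_aeval_traceSum_eq [Fact p.Prime] {ι A S : Type*} [Fintype ι] [DecidableEq ι]
    [CommRing A] [IsDomain A] [Algebra (ZMod p) A] [CommRing S] [CharP S p] [Algebra A S]
    (g : MvPolynomial (ι × ι) A) (r : A)
    (hg : ∀ Y : Matrix ι ι (ZMod p),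
      MvPolynomial.eval (fun i => algebraMap (ZMod p) A (Y i.1 i.2)) g =
        if Y.det = 0 then 0 else r) (y : ι → S) :
    ∃ K : ℕ, ∀ N : ι → ℕ, (∀ l, K ≤ N l) →
      MvPolynomial.coeff ((p - 1) • ∑ l, Finsupp.single l (p ^ N l))
        (MvPolynomial.aeval (fun i : ι × ι => traceSum p (N i.1) i.1 (y i.2)) g) =
      r • (Matrix.of fun l i => y i ^ p ^ N l).det ^ (p - 1) := by
  have hp : p.Prime := Fact.out
  have hp2 := hp.two_le
  -- By Fermat, `r · det^(p-1)` has the same values as `g` on matrices over `𝔽_p`, so the two differ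
  -- by a combination of the polynomials `X_i^p - X_i`.
  obtain ⟨h, hh⟩ := exists_eq_sum_mul_pow_sub (p := p) (g - MvPolynomial.C r *
    (Matrix.of fun l i => MvPolynomial.X (l, i)).det ^ (p - 1)) (by
      intro Y
      have hd := algHom_det_X (MvPolynomial.eval fun i : ι × ι => algebraMap (ZMod p) A (Y i))
      have hd' : (Matrix.of fun l i => MvPolynomial.eval
          (fun i : ι × ι => algebraMap (ZMod p) A (Y i)) (MvPolynomial.X (l, i))).det =
          algebraMap (ZMod p) A (Matrix.of fun a b => Y (a, b)).det := by
        rw [RingHom.map_det]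
        congr 1
        ext a b
        simp
      have hY := hg (Matrix.of fun a b => Y (a, b))
      simp only [Matrix.of_apply, Prod.mk.eta] at hY
      rw [map_sub, map_mul, map_pow, hd, hd', MvPolynomial.eval_C, hY, ← map_pow]
      split_ifs with h0
      · rw [h0, zero_pow (by omega), map_zero, mul_zero, sub_zero]
      · rw [ZMod.pow_card_sub_one_eq_one h0, map_one, mul_one, sub_self])
  obtain ⟨D, hD⟩ : ∃ D, ∀ i ∈ h.support, (h i).totalDegree ≤ D :=
    ⟨_, fun i hi => Finset.le_sup (f := fun i => (h i).totalDegree) hi⟩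
  -- The degrees of the cofactors bound the digit sums, so the error terms contribute nothing once
  -- every `N l` exceeds `D`. The main term contributes its top coefficient.
  refine ⟨D + 1, fun N hN => ?_⟩
  have hdet := (HasTop.det (Y := Matrix.of fun l i => traceSum p (N l) l (y i))
    (b := fun l => Finsupp.single l (p ^ N l)) (c := Matrix.of fun l i => y i ^ p ^ N l)
    fun l i => traceSum_hasTop (N l) l (y i)).pow (p - 1)
  have hd := algHom_det_X (MvPolynomial.aeval (R := A)
    fun i : ι × ι => traceSum p (N i.1) i.1 (y i.2)).toRingHom
  simp only [AlgHom.toRingHom_eq_coe, RingHom.coe_coe, MvPolynomial.aeval_X] at hd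
  rw [sub_eq_iff_eq_add] at hh
  rw [hh, map_add, MvPolynomial.coeff_add, map_sum, MvPolynomial.coeff_sum, Finset.sum_eq_zero,
    zero_add, map_mul, map_pow, hd, MvPolynomial.algHom_C, MvPolynomial.algebraMap_apply,
    MvPolynomial.coeff_C_mul, hdet.2, Algebra.smul_def]
  rintro ⟨l, i⟩ hi
  rw [map_mul, map_sub, map_pow, MvPolynomial.aeval_X]
  exact coeff_mul_traceSum_pow_sub (aeval_traceSum_digitBounded (h (l, i)) N y l) (y i)
    (lt_of_le_of_lt (hD _ hi) (hN l)) (nsmul_sum_single_apply (p - 1) (fun l => p ^ N l) l)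

/-- Coefficients with respect to an outer family of variables commute with the extension of
scalars of a functional. -/
theorem extendFunctional_coeff [Fact p.Prime] {σ ι A : Type*} [CommRing A] [Algebra (ZMod p) A]
    (ψ : MvPolynomial σ (ZMod p) →ₗ[ZMod p] ZMod p) (k : ι →₀ ℕ)
    (z : MvPolynomial σ (MvPolynomial ι A)) :
    extendFunctional A ψ (MvPolynomial.coeff k (MvPolynomial.eval₂ (MvPolynomial.map MvPolynomial.C)
        (fun i => MvPolynomial.C (MvPolynomial.X i)) z : MvPolynomial ι (MvPolynomial σ A))) =
      MvPolynomial.coeff k (extendFunctional (MvPolynomial ι A) ψ z) := by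
  induction z using MvPolynomial.induction_on' with
  | monomial m a =>
    have e : (MvPolynomial.eval₂ (MvPolynomial.map MvPolynomial.C)
        (fun i => MvPolynomial.C (MvPolynomial.X i)) (MvPolynomial.monomial m a) :
          MvPolynomial ι (MvPolynomial σ A)) =
        MvPolynomial.map MvPolynomial.C a * MvPolynomial.C (MvPolynomial.monomial m 1) := by
      rw [MvPolynomial.eval₂_monomial]
      congr 1
      rw [MvPolynomial.monomial_eq]
      simp only [Finsupp.prod, map_one, one_mul, map_prod, map_pow]
    rw [e, mul_comm, MvPolynomial.coeff_C_mul, MvPolynomial.coeff_map, mul_comm,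
      MvPolynomial.C_mul_monomial, mul_one, extendFunctional_monomial, extendFunctional_monomial,
      IsScalarTower.algebraMap_apply (ZMod p) A (MvPolynomial ι A), MvPolynomial.algebraMap_eq,
      mul_comm (_ : MvPolynomial ι A), MvPolynomial.coeff_C_mul, mul_comm]
  | add f g hf hg =>
    rw [MvPolynomial.eval₂_add, MvPolynomial.coeff_add, map_add, hf, hg, map_add,
      MvPolynomial.coeff_add]

end Coefficients

/-! ### Detecting full row rank modulo `p` -/

section Rank

variable {p : ℕ}

/-- The rows of `M` are linearly independent. -/
def RowsIndep {d n : ℕ} (M : Matrix (Fin d) (Fin n) (ZMod p)) : Prop :=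
  ∀ w, Matrix.vecMul w M = 0 → w = 0

theorem RowsIndep.mul_right {d m n : ℕ} {v : Matrix (Fin d) (Fin m) (ZMod p)}
    {Y : Matrix (Fin m) (Fin n) (ZMod p)} (hv : RowsIndep v) (hY : RowsIndep Y) :
    RowsIndep (v * Y) :=
  fun w hw => hv w (hY _ (by rwa [Matrix.vecMul_vecMul]))

variable [Fact p.Prime]

theorem rowsIndep_iff_det_ne_zero {n : ℕ} (Y : Matrix (Fin n) (Fin n) (ZMod p)) :
    RowsIndep Y ↔ Y.det ≠ 0 := by
  rw [Ne, ← Matrix.exists_vecMul_eq_zero_iff, RowsIndep]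
  push Not
  exact ⟨fun h v hv h0 => hv (h v h0), fun h v h0 => by_contra fun hv => h v hv h0⟩

/-- The rows of `v` are a basis of the hyperplane orthogonal to `η`. -/
theorem exists_rowsIndep_of_ne_zero {m : ℕ} {η : Fin (m + 1) → ZMod p} (hη : η ≠ 0) :
    ∃ v : Matrix (Fin m) (Fin (m + 1)) (ZMod p), RowsIndep v ∧
      ∀ k, dotProduct η k = 0 ↔ ∃ w, Matrix.vecMul w v = k := by
  let φ : (Fin (m + 1) → ZMod p) →ₗ[ZMod p] ZMod p := dotProductBilin (ZMod p) (ZMod p) η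
  have hφ (k) : φ k = dotProduct η k := rfl
  have hne : φ ≠ 0 := by
    intro h0
    apply hη
    funext i
    have := hφ (Pi.single i 1)
    rw [h0] at this
    simpa using this.symm
  have hr : Module.finrank (ZMod p) (LinearMap.ker φ) = m := by
    have h1 := LinearMap.finrank_range_add_finrank_ker φ
    rw [LinearMap.range_eq_top.2 (LinearMap.surjective hne), finrank_top, Module.finrank_self,
      Module.finrank_fin_fun] at h1
    omega
  let b := Module.finBasisOfFinrankEq (ZMod p) (LinearMap.ker φ) hr
  have hw (w : Fin m → ZMod p) : Matrix.vecMul w (Matrix.of fun i => (b i : Fin (m + 1) → ZMod p)) =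
      (∑ i, w i • b i : LinearMap.ker φ) := by
    rw [Matrix.vecMul_eq_sum, Submodule.coe_sum]
    rfl
  refine ⟨Matrix.of fun i => b i, fun w h0 => ?_, fun k => ⟨fun hk => ?_, ?_⟩⟩
  · rw [hw] at h0
    have h1 := (Fintype.linearIndependent_iff.1 b.linearIndependent) w (Subtype.ext h0)
    exact funext h1
  · refine ⟨b.repr ⟨k, hk⟩, ?_⟩
    rw [hw, b.sum_repr]
  · rintro ⟨w, rfl⟩
    rw [hw]
    exact (∑ i, w i • b i : LinearMap.ker φ).2

/-- A polynomial of degree `p - 1 < (p - 1)(m + 1)` sums to zero over `𝔽_p^(m+1)`, as in the proof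
of Chevalley–Warning. -/
theorem sum_dotProduct_pow_eq_zero {m : ℕ} (hm : 1 ≤ m) (k : Fin (m + 1) → ZMod p) :
    ∑ η : Fin (m + 1) → ZMod p, dotProduct η k ^ (p - 1) = 0 := by
  have hp2 := (Fact.out : p.Prime).two_le
  let f : MvPolynomial (Fin (m + 1)) (ZMod p) :=
    (∑ i, MvPolynomial.C (k i) * MvPolynomial.X i) ^ (p - 1)
  have hf : f.IsHomogeneous (1 * (p - 1)) := by
    refine MvPolynomial.IsHomogeneous.pow (MvPolynomial.IsHomogeneous.sum _ _ _ fun i _ => ?_) _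
    exact (MvPolynomial.isHomogeneous_X _ i).C_mul _
  have h := MvPolynomial.sum_eval_eq_zero f (by
    rw [ZMod.card, Fintype.card_fin]
    refine hf.totalDegree_le.trans_lt ?_
    rw [mul_comm]
    exact Nat.mul_lt_mul_of_pos_left (by omega) (by omega))
  rw [← h]
  refine Finset.sum_congr rfl fun η _ => ?_
  simp [f, dotProduct, mul_comm]

open Classical in
-- The rows of `v η * Y` are independent exactly when the left kernel of `Y` meets the hyperplane
-- `η^⊥` trivially. If the kernel is zero, all `p^(m+1) - 1` nonzero `η` count, which gives `-1`. If
-- it is a line through `k`, the `η` with `η · k ≠ 0` count, and their number is `∑ (η · k)^(p-1) =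
-- 0`. If it has dimension at least two, it meets every hyperplane and no `η` counts.
theorem sum_rowsIndep_mul {m n : ℕ} (hm : 1 ≤ m)
    (v : (Fin (m + 1) → ZMod p) → Matrix (Fin m) (Fin (m + 1)) (ZMod p))
    (hv : ∀ η ≠ 0, RowsIndep (v η) ∧ ∀ k, dotProduct η k = 0 ↔ ∃ w, Matrix.vecMul w (v η) = k)
    (Y : Matrix (Fin (m + 1)) (Fin n) (ZMod p)) :
    ∑ η, (if η ≠ 0 ∧ RowsIndep (v η * Y) then (1 : ZMod p) else 0) =
      if RowsIndep Y then -1 else 0 := by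
  have hp2 := (Fact.out : p.Prime).two_le
  split_ifs with hY
  · have e (η : Fin (m + 1) → ZMod p) :
        (if η ≠ 0 ∧ RowsIndep (v η * Y) then (1 : ZMod p) else 0) = 1 - if η = 0 then 1 else 0 := by
      by_cases hη : η = 0
      · simp [hη]
      · simp [hη, (hv η hη).1.mul_right hY]
    simp [e, Finset.sum_sub_distrib, ZMod.card]
  · unfold RowsIndep at hY
    push Not at hY
    obtain ⟨k, hkY, hk⟩ := hY
    by_cases h0 : ∃ η, η ≠ 0 ∧ RowsIndep (v η * Y)
    · obtain ⟨η₀, hη₀, hr⟩ := h0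
      have inter (a) (ha : dotProduct η₀ a = 0) (haY : Matrix.vecMul a Y = 0) : a = 0 := by
        obtain ⟨w, rfl⟩ := ((hv η₀ hη₀).2 a).1 ha
        rw [hr w (by rwa [← Matrix.vecMul_vecMul]), Matrix.zero_vecMul]
      have hk0 : dotProduct η₀ k ≠ 0 := fun h => hk (inter k h hkY)
      -- A hyperplane meeting the left kernel trivially forces that kernel to be the line spanned by
      -- `k`.
      have line (a) (haY : Matrix.vecMul a Y = 0) :
          a = (dotProduct η₀ a / dotProduct η₀ k) • k := by
        rw [← sub_eq_zero]
        refine inter _ ?_ ?_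
        · rw [dotProduct_sub, dotProduct_smul, smul_eq_mul, div_mul_cancel₀ _ hk0, sub_self]
        · rw [Matrix.sub_vecMul, Matrix.smul_vecMul, haY, hkY, smul_zero, sub_zero]
      refine (Finset.sum_congr rfl fun η _ => ?_).trans (sum_dotProduct_pow_eq_zero hm k)
      by_cases hηk : dotProduct η k = 0
      · rw [hηk, zero_pow (by omega), if_neg]
        rintro ⟨hη, hr'⟩
        obtain ⟨w, rfl⟩ := ((hv η hη).2 k).1 hηk
        apply hk
        rw [hr' w (by rwa [← Matrix.vecMul_vecMul]), Matrix.zero_vecMul]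
      · rw [ZMod.pow_card_sub_one_eq_one hηk, if_pos]
        have hη : η ≠ 0 := by
          rintro rfl
          exact hηk (zero_dotProduct k)
        refine ⟨hη, fun w hw => (hv η hη).1 w ?_⟩
        rw [← Matrix.vecMul_vecMul] at hw
        have h1 := line _ hw
        have h2 := ((hv η hη).2 _).2 ⟨w, rfl⟩
        rw [h1, dotProduct_smul, smul_eq_mul] at h2
        rw [h1, (mul_eq_zero.1 h2).resolve_right hηk, zero_smul]
    · push Not at h0
      exact Finset.sum_eq_zero fun η _ => if_neg fun h => h0 η h.1 h.2

open Classical in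
/-- Linear independence of the rows of `Y` can be detected on combinations of `d` rows. -/
theorem exists_sum_rowsIndep_mul {d : ℕ} (hd : 1 ≤ d) (m : ℕ) (hdm : d ≤ m) :
    ∃ (ι : Type) (_ : Fintype ι) (c : ι → ZMod p) (u : ι → Matrix (Fin d) (Fin m) (ZMod p)),
      ∀ (n : ℕ) (Y : Matrix (Fin m) (Fin n) (ZMod p)),
        ∑ i, c i * (if RowsIndep (u i * Y) then 1 else 0) = if RowsIndep Y then 1 else 0 := by
  induction m, hdm using Nat.le_induction with
  | base => exact ⟨Unit, inferInstance, fun _ => 1, fun _ => 1, fun n Y => by simp⟩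
  | succ m hdm ih =>
    obtain ⟨ι, _, c, u, h⟩ := ih
    have hex (η : Fin (m + 1) → ZMod p) : ∃ v : Matrix (Fin m) (Fin (m + 1)) (ZMod p),
        η ≠ 0 → RowsIndep v ∧ ∀ k, dotProduct η k = 0 ↔ ∃ w, Matrix.vecMul w v = k := by
      by_cases hη : η = 0
      · exact ⟨0, fun h => absurd hη h⟩
      · exact (exists_rowsIndep_of_ne_zero hη).imp fun v hv _ => hv
    choose v hv using hex
    -- Each hyperplane supplies `m` combinations of the `m + 1` rows, to which the previous stage
    -- applies. The sign compensates for the value `-1` in `sum_rowsIndep_mul`.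
    refine ⟨(Fin (m + 1) → ZMod p) × ι, inferInstance,
      fun a => if a.1 ≠ 0 then - c a.2 else 0, fun a => u a.2 * v a.1, fun n Y => ?_⟩
    rw [Fintype.sum_prod_type]
    have e (η : Fin (m + 1) → ZMod p) :
        ∑ i, (if η ≠ 0 then - c i else 0) * (if RowsIndep (u i * v η * Y) then 1 else 0) =
          - if η ≠ 0 ∧ RowsIndep (v η * Y) then 1 else 0 := by
      by_cases hη : η = 0
      · simp [hη]
      · simp only [hη, ne_eq, not_false_eq_true, if_true, true_and, neg_mul,
          Finset.sum_neg_distrib, Matrix.mul_assoc]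
        rw [h n (v η * Y)]
    simp only [e, Finset.sum_neg_distrib]
    rw [sum_rowsIndep_mul (hd.trans hdm) v hv Y]
    split_ifs <;> simp

end Rank

/-! ### Values of invariants on tuples of vectors -/

section Orbits

variable {p : ℕ} [Fact p.Prime] {n : ℕ}

/-- The combination with coefficients `t` of the rows of `M`. -/
def rowComb {d : ℕ} {A : Type*} [CommRing A] [Algebra (ZMod p) A] (t : Fin d → A)
    (M : Matrix (Fin d) (Fin n) (ZMod p)) (i : Fin n) : A :=
  ∑ j, M j i • t j

theorem aeval_rowComb_mul {d : ℕ} {A : Type*} [CommRing A] [Algebra (ZMod p) A] (t : Fin d → A)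
    {x : MvPolynomial (Fin n) (ZMod p)} (hx : x ∈ invariants p n)
    (M : Matrix (Fin d) (Fin n) (ZMod p)) (g : GL (Fin n) (ZMod p)) :
    MvPolynomial.aeval (rowComb t (M * (g : Matrix (Fin n) (Fin n) (ZMod p)))) x =
      MvPolynomial.aeval (rowComb t M) x := by
  conv_rhs => rw [← mem_invariants.1 hx g]
  rw [subst, ← AlgHom.comp_apply, MvPolynomial.comp_aeval]
  congr 2
  funext i
  simp only [rowComb, map_sum, map_smul, MvPolynomial.aeval_X, Matrix.mul_apply, Finset.smul_sum,
    Finset.sum_smul, smul_smul]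
  rw [Finset.sum_comm]
  exact Finset.sum_congr rfl fun _ _ => Finset.sum_congr rfl fun _ _ => by rw [mul_comm]

theorem exists_GL_of_linearEquiv (e : (Fin n → ZMod p) ≃ₗ[ZMod p] (Fin n → ZMod p)) :
    ∃ g : GL (Fin n) (ZMod p), ∀ w,
      Matrix.vecMul w (g : Matrix (Fin n) (Fin n) (ZMod p)) = e w := by
  have h1 : (LinearMap.toMatrix' e.toLinearMap) * (LinearMap.toMatrix' e.symm.toLinearMap) = 1 := by
    rw [← LinearMap.toMatrix'_comp]; simp
  have h2 : (LinearMap.toMatrix' e.symm.toLinearMap) * (LinearMap.toMatrix' e.toLinearMap) = 1 := by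
    rw [← LinearMap.toMatrix'_comp]; simp
  refine ⟨⟨(LinearMap.toMatrix' e.toLinearMap).transpose,
    (LinearMap.toMatrix' e.symm.toLinearMap).transpose, ?_, ?_⟩, fun w => ?_⟩
  · rw [← Matrix.transpose_mul, h2, Matrix.transpose_one]
  · rw [← Matrix.transpose_mul, h1, Matrix.transpose_one]
  · change Matrix.vecMul w (LinearMap.toMatrix' e.toLinearMap).transpose = _
    rw [Matrix.vecMul_transpose, LinearMap.toMatrix'_mulVec]
    rfl

/-- The `d × n` matrix `(1 | 0)`. -/
def truncMatrix (p d n : ℕ) : Matrix (Fin d) (Fin n) (ZMod p) :=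
  Matrix.of fun j i => if (j : ℕ) = i then 1 else 0

theorem vecMul_truncMatrix {d : ℕ} (w : Fin d → ZMod p) (i : Fin n) :
    Matrix.vecMul w (truncMatrix p d n) i = if h : (i : ℕ) < d then w ⟨i, h⟩ else 0 := by
  simp only [Matrix.vecMul, dotProduct, truncMatrix, Matrix.of_apply, mul_ite, mul_one, mul_zero]
  split_ifs with h
  · rw [Finset.sum_eq_single ⟨i, h⟩]
    · simp
    · intro j _ hj
      rw [if_neg]
      rintro hji
      exact hj (Fin.ext hji)
    · simp
  · refine Finset.sum_eq_zero fun j _ => if_neg ?_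
    have := j.2
    omega

theorem truncMatrix_rowsIndep {d : ℕ} (hd : d ≤ n) : RowsIndep (truncMatrix p d n) := by
  intro w hw
  funext j
  have := congrFun hw (Fin.castLE hd j)
  rw [vecMul_truncMatrix] at this
  simpa using this

/-- The isomorphism between the two images extends to an automorphism of the finite-dimensional
ambient space. -/
theorem exists_linearEquiv_comp_eq {k V V' : Type*} [Field k] [AddCommGroup V] [Module k V]
    [AddCommGroup V'] [Module k V'] [FiniteDimensional k V] (f g : V' →ₗ[k] V)
    (hf : Function.Injective f) (hg : Function.Injective g) :
    ∃ e : V ≃ₗ[k] V, ∀ w, e (f w) = g w := by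
  obtain ⟨e, he⟩ := Submodule.exists_linearEquiv_restrict_eq
    ((LinearEquiv.ofInjective f hf).symm.trans (LinearEquiv.ofInjective g hg))
  refine ⟨e, fun w => ?_⟩
  have h := he (LinearEquiv.ofInjective f hf w)
  rw [LinearEquiv.trans_apply, LinearEquiv.symm_apply_apply] at h
  exact h.symm

theorem RowsIndep.exists_mul_eq_truncMatrix {d : ℕ} (hd : d ≤ n)
    {M : Matrix (Fin d) (Fin n) (ZMod p)} (hM : RowsIndep M) :
    ∃ g : GL (Fin n) (ZMod p), M * (g : Matrix (Fin n) (Fin n) (ZMod p)) = truncMatrix p d n := by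
  have inj {M : Matrix (Fin d) (Fin n) (ZMod p)} (hM : RowsIndep M) :
      Function.Injective M.vecMulLinear := (injective_iff_map_eq_zero _).2 hM
  obtain ⟨e, he⟩ := exists_linearEquiv_comp_eq _ _ (inj hM) (inj (truncMatrix_rowsIndep hd))
  obtain ⟨g, hg⟩ := exists_GL_of_linearEquiv e
  refine ⟨g, ?_⟩
  have h (w : Fin d → ZMod p) : Matrix.vecMul w (M * (g : Matrix (Fin n) (Fin n) (ZMod p))) =
      Matrix.vecMul w (truncMatrix p d n) := by
    rw [← Matrix.vecMul_vecMul, hg]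
    exact he w
  exact Matrix.vecMul_injective (funext h)

/-- The row space has dimension `r < d`; an automorphism moves it into the first `r ≤ d - 1`
coordinates. -/
theorem exists_mul_eq_zero_of_not_rowsIndep {d : ℕ} (hd : d ≤ n)
    {M : Matrix (Fin d) (Fin n) (ZMod p)} (hM : ¬ RowsIndep M) :
    ∃ g : GL (Fin n) (ZMod p), ∀ j (i : Fin n), d ≤ (i : ℕ) + 1 →
      (M * (g : Matrix (Fin n) (Fin n) (ZMod p))) j i = 0 := by
  set W := LinearMap.range M.vecMulLinear with hW
  set r := Module.finrank (ZMod p) W with hr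
  have hrd : r < d := by
    have h1 := LinearMap.finrank_range_add_finrank_ker M.vecMulLinear
    rw [Module.finrank_fin_fun, ← hW, ← hr] at h1
    have h2 : 0 < Module.finrank (ZMod p) (LinearMap.ker M.vecMulLinear) := by
      rw [Nat.pos_iff_ne_zero, Ne, Submodule.finrank_eq_zero]
      intro h
      exact hM fun w hw => (LinearMap.ker_eq_bot'.1 h) w hw
    omega
  let b := Module.finBasisOfFinrankEq (ZMod p) W hr.symm
  obtain ⟨e, he⟩ := exists_linearEquiv_comp_eq (W.subtype ∘ₗ b.equivFun.symm.toLinearMap)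
    (truncMatrix p r n).vecMulLinear (W.injective_subtype.comp b.equivFun.symm.injective)
    ((injective_iff_map_eq_zero _).2 (truncMatrix_rowsIndep (hrd.le.trans hd)))
  obtain ⟨g, hg⟩ := exists_GL_of_linearEquiv e
  refine ⟨g, fun j i hi => ?_⟩
  have hj : M j ∈ W := ⟨Pi.single j 1, Matrix.single_one_vecMul j M⟩
  have h1 : (M * (g : Matrix (Fin n) (Fin n) (ZMod p))) j i = e (M j) i := by
    rw [← hg]; rfl
  have h2 := he (b.equivFun ⟨M j, hj⟩)
  simp only [LinearMap.comp_apply, LinearEquiv.coe_coe, LinearEquiv.symm_apply_apply,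
    Submodule.subtype_apply, Matrix.vecMulLinear_apply] at h2
  rw [h1, h2, vecMul_truncMatrix, dif_neg (by omega)]

/-- The restriction of a polynomial to the first `d` coordinates. -/
noncomputable def truncate (d : ℕ) :
    MvPolynomial (Fin n) (ZMod p) →ₐ[ZMod p] MvPolynomial (Fin n) (ZMod p) :=
  MvPolynomial.aeval fun i => if (i : ℕ) < d then MvPolynomial.X i else 0

theorem aeval_eq_zero_of_truncate_eq_zero {A : Type*} [CommRing A] [Algebra (ZMod p) A] {d : ℕ}
    {x : MvPolynomial (Fin n) (ZMod p)} (hx : truncate d x = 0) (v : Fin n → A)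
    (hv : ∀ i : Fin n, d ≤ i → v i = 0) : MvPolynomial.aeval v x = 0 := by
  rw [← map_zero (MvPolynomial.aeval (R := ZMod p) v), ← hx, truncate, ← AlgHom.comp_apply,
    MvPolynomial.comp_aeval]
  congr 2
  funext i
  split_ifs with h
  · simp
  · simp [hv i (not_lt.1 h)]

open Classical in
-- By invariance, only the `GL_n`-orbit of `M` matters. Independent rows can be brought to `(1 |
-- 0)`, which yields the restriction to `d` coordinates; dependent rows can be brought into `d - 1`
-- columns, where `x` vanishes by hypothesis.
theorem aeval_rowComb_eq_ite {d : ℕ} (hd : d ≤ n) (hd1 : 1 ≤ d)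
    {x : MvPolynomial (Fin n) (ZMod p)} (hx : x ∈ invariants p n) (h0 : truncate (d - 1) x = 0)
    (M : Matrix (Fin d) (Fin n) (ZMod p)) :
    MvPolynomial.aeval (rowComb (fun j => MvPolynomial.X (Fin.castLE hd j)) M) x =
      (if RowsIndep M then truncate d x else 0 : MvPolynomial (Fin n) (ZMod p)) := by
  split_ifs with hM
  · obtain ⟨g, hg⟩ := hM.exists_mul_eq_truncMatrix hd
    rw [← aeval_rowComb_mul _ hx M g, hg, truncate]
    congr 2
    funext i
    simp only [rowComb, truncMatrix, Matrix.of_apply, ite_smul, one_smul, zero_smul]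
    split_ifs with h
    · rw [Finset.sum_eq_single ⟨i, h⟩]
      · simp
      · intro j _ hj
        exact if_neg fun hji => hj (Fin.ext hji)
      · simp
    · refine Finset.sum_eq_zero fun j _ => if_neg ?_
      have := j.2
      omega
  · obtain ⟨g, hg⟩ := exists_mul_eq_zero_of_not_rowsIndep hd hM
    rw [← aeval_rowComb_mul _ hx M g]
    refine aeval_eq_zero_of_truncate_eq_zero h0 _ fun i hi => ?_
    exact Finset.sum_eq_zero fun j _ => by rw [hg j i (by omega), zero_smul]

end Orbits

/-! ### Moore determinants in cyclic submodules -/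

section Moore

variable {p : ℕ}

/-- The determinant of the matrix `(y_i^(p^(N_l)))`. -/
noncomputable def mooreDet (p : ℕ) {ι : Type*} [Fintype ι] [DecidableEq ι] (R : Type*) [CommRing R]
    (N : ι → ℕ) : MvPolynomial ι R :=
  (Matrix.of fun l i => MvPolynomial.X i ^ p ^ N l).det

theorem map_mooreDet {ι : Type*} [Fintype ι] [DecidableEq ι] {R S : Type*} [CommRing R]
    [CommRing S] (φ : R →+* S) (N : ι → ℕ) :
    MvPolynomial.map φ (mooreDet p R N) = mooreDet p S N := by
  rw [mooreDet, RingHom.map_det, mooreDet]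
  congr 1
  ext1 l i
  simp

variable [Fact p.Prime] {n : ℕ}

/-- For distinct exponents, the diagonal monomial `∏ y_i^(p^(N i))` arises from the identity
permutation only. -/
theorem mooreDet_ne_zero {ι : Type*} [Fintype ι] [DecidableEq ι] {R : Type*} [CommRing R]
    [Nontrivial R] {N : ι → ℕ} (hN : Function.Injective N) : mooreDet p R N ≠ 0 := by
  have hp2 := (Fact.out : p.Prime).two_le
  have e (τ : Equiv.Perm ι) : ∏ i, MvPolynomial.X (R := R) i ^ p ^ N (τ i) =
      MvPolynomial.monomial (∑ i, Finsupp.single i (p ^ N (τ i))) 1 := by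
    simp_rw [MvPolynomial.X_pow_eq_monomial]
    rw [← MvPolynomial.monomial_sum_one]
  have ev (τ : Equiv.Perm ι) (j : ι) :
      (∑ i, Finsupp.single i (p ^ N (τ i))) j = p ^ N (τ j) := by
    rw [Finsupp.finsetSum_apply, Finset.sum_eq_single j]
    · simp
    · intro b _ hb
      rw [Finsupp.single_apply, if_neg hb]
    · simp
  have h : MvPolynomial.coeff (∑ i, Finsupp.single i (p ^ N i)) (mooreDet p R N) = 1 := by
    rw [mooreDet, Matrix.det_apply, MvPolynomial.coeff_sum, Finset.sum_eq_single 1]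
    · have := e 1
      simp only [Equiv.Perm.one_apply] at this
      simp [this]
    · intro τ _ hτ
      have hne : MvPolynomial.coeff (∑ i, Finsupp.single i (p ^ N i))
          (∏ i, MvPolynomial.X (R := R) i ^ p ^ N (τ i)) = 0 := by
        rw [e, MvPolynomial.coeff_monomial, if_neg]
        intro h
        apply hτ
        ext j
        have h1 := DFunLike.congr_fun h j
        have h2 := ev 1 j
        simp only [Equiv.Perm.one_apply] at h2
        rw [ev, h2] at h1
        rw [hN (Nat.pow_right_injective hp2 h1), Equiv.Perm.one_apply]
      simp only [Matrix.of_apply]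
      rcases Int.units_eq_one_or (Equiv.Perm.sign τ) with hs | hs <;> simp [hs, hne]
    · simp
  intro h0
  rw [h0, MvPolynomial.coeff_zero] at h
  exact zero_ne_one h

theorem exists_truncate (x : MvPolynomial (Fin n) (ZMod p)) (hx : x ≠ 0)
    (hc : MvPolynomial.constantCoeff x = 0) :
    ∃ d, 1 ≤ d ∧ d ≤ n ∧ truncate d x ≠ 0 ∧ truncate (d - 1) x = 0 := by
  classical
  have hn : truncate n x ≠ 0 := by
    have : (fun i : Fin n => if (i : ℕ) < n then MvPolynomial.X (R := ZMod p) i else 0) =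
        MvPolynomial.X := funext fun i => if_pos i.2
    rwa [truncate, this, MvPolynomial.aeval_X_left_apply]
  have h0 : truncate 0 x = 0 := by
    have : (fun i : Fin n => if (i : ℕ) < 0 then MvPolynomial.X (R := ZMod p) i else 0) =
        0 := funext fun i => if_neg (Nat.not_lt_zero _)
    rw [truncate, this, MvPolynomial.aeval_zero, hc, map_zero]
  have hex : ∃ d, truncate d x ≠ 0 := ⟨n, hn⟩
  have h1 : 1 ≤ Nat.find hex := by
    rw [Nat.one_le_iff_ne_zero]
    intro h
    have := Nat.find_spec hex
    rw [h] at this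
    exact this h0
  exact ⟨Nat.find hex, h1, Nat.find_min' hex hn, Nat.find_spec hex,
    not_not.1 (Nat.find_min hex (Nat.sub_lt h1 Nat.one_pos))⟩

/-- The substitution `y_i ↦ ∑ r_l (τ_l y_i)^(p^J)` of `x` has coefficients in any stable subspace
containing `x`. -/
theorem extendFunctional_coeff_aeval_traceSum {σ ι A : Type*} [Fintype ι] [CommRing A]
    [Algebra (ZMod p) A] (N : Submodule (ZMod p) (MvPolynomial σ (ZMod p)))
    (hN : ∀ k, ∀ f ∈ N, steenrodPower p σ k f ∈ N)
    (ψ : MvPolynomial σ (ZMod p) →ₗ[ZMod p] ZMod p) (hψ : ∀ f ∈ N, ψ f = 0)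
    {x : MvPolynomial σ (ZMod p)} (hx : x ∈ N) {m : ℕ} (hm : x.IsHomogeneous m) (r : ι → A)
    (E : ι → ℕ) (b : ι →₀ ℕ) :
    extendFunctional A ψ (MvPolynomial.coeff b (MvPolynomial.aeval (fun i =>
      ∑ l, MvPolynomial.C (MvPolynomial.C (r l)) * traceSum p (E l) l (MvPolynomial.X i)) x)) =
        0 := by
  let M := ∑ l, E l
  have hM (l : ι) : E l ≤ M := Finset.single_le_sum (fun _ _ => Nat.zero_le _) (Finset.mem_univ l)
  -- The choice `λ_J = ∑ r_l τ_l^(p^J)`, with the `l`-th summand cut off after `J = E l`, turns the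
  -- additive polynomial into a combination of truncated traces. The map `sw` exchanges the
  -- variables `τ` and `y`.
  let lam : ℕ → MvPolynomial ι A := fun J =>
    ∑ l, if J < E l + 1 then MvPolynomial.C (r l) * MvPolynomial.X l ^ p ^ J else 0
  let sw : MvPolynomial σ (MvPolynomial ι A) →+* MvPolynomial ι (MvPolynomial σ A) :=
    MvPolynomial.eval₂Hom (MvPolynomial.map MvPolynomial.C)
      (fun i => MvPolynomial.C (MvPolynomial.X i))
  have hsw : sw.comp (MvPolynomial.aeval (R := ZMod p) (additivePoly (σ := σ) p (M + 1) lam)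
      ).toRingHom = (MvPolynomial.aeval (R := ZMod p) (fun i : σ =>
      ∑ l, MvPolynomial.C (MvPolynomial.C (r l)) *
        traceSum p (E l) l (MvPolynomial.X (R := A) i))).toRingHom := by
    apply ringHom_ext_of_X
    intro i
    simp only [RingHom.comp_apply, AlgHom.toRingHom_eq_coe, RingHom.coe_coe, MvPolynomial.aeval_X,
      additivePoly, map_sum, map_mul, map_pow, sw, MvPolynomial.coe_eval₂Hom, MvPolynomial.eval₂_C,
      MvPolynomial.eval₂_X, lam, traceSum, Finset.sum_mul, Finset.mul_sum]
    rw [Finset.sum_comm]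
    refine Finset.sum_congr rfl fun l _ => ?_
    have hsub : Finset.range (E l + 1) ⊆ Finset.range (M + 1) :=
      Finset.range_subset_range.2 (by have := hM l; omega)
    rw [← Finset.sum_subset hsub]
    · refine Finset.sum_congr rfl fun J hJ => ?_
      rw [if_pos (Finset.mem_range.1 hJ)]
      simp only [map_mul, map_pow, MvPolynomial.map_C, MvPolynomial.map_X]
      ring
    · intro J _ hJ
      rw [if_neg (fun h => hJ (Finset.mem_range.2 h)), map_zero, zero_mul]
  have h := RingHom.congr_fun hsw x
  simp only [RingHom.comp_apply, AlgHom.toRingHom_eq_coe, RingHom.coe_coe] at h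
  rw [← h]
  simp only [sw, MvPolynomial.coe_eval₂Hom]
  rw [extendFunctional_coeff, extendFunctional_aeval_additivePoly N hN ψ hψ hx hm,
    MvPolynomial.coeff_zero]

open Classical in
-- The tests for full row rank apply to `d` combinations `u k * Y` of the rows of `Y`, and `x`
-- itself performs each of them by `aeval_rowComb_eq_ite`. The `s k l` are the linear forms with
-- which the rows of `Y` are then combined.
theorem exists_polynomial_eval_eq_ite {d : ℕ} (hd : d ≤ n) (hd1 : 1 ≤ d)
    {x : MvPolynomial (Fin n) (ZMod p)} (hx : x ∈ invariants p n)
    (h0 : truncate (d - 1) x = 0) :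
    ∃ (ι : Type) (_ : Fintype ι) (c : ι → ZMod p)
      (s : ι → Fin n → MvPolynomial (Fin n) (ZMod p)), ∀ Y : Matrix (Fin n) (Fin n) (ZMod p),
        ∑ k, c k • MvPolynomial.aeval (fun i => ∑ l, s k l * MvPolynomial.C (Y l i)) x =
          if Y.det = 0 then 0 else truncate d x := by
  obtain ⟨ι, _, c, u, hu⟩ := exists_sum_rowsIndep_mul (p := p) hd1 n hd
  refine ⟨ι, inferInstance, c, fun k => rowComb (fun j => MvPolynomial.X (Fin.castLE hd j)) (u k),
    fun Y => ?_⟩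
  have e (k : ι) : (fun i => ∑ l, rowComb (fun j => MvPolynomial.X (Fin.castLE hd j)) (u k) l *
      MvPolynomial.C (Y l i)) =
      rowComb (fun j => MvPolynomial.X (R := ZMod p) (Fin.castLE hd j)) (u k * Y) := by
    funext i
    simp only [rowComb, Matrix.mul_apply, Finset.sum_mul, Finset.sum_smul]
    rw [Finset.sum_comm]
    refine Finset.sum_congr rfl fun j _ => Finset.sum_congr rfl fun l _ => ?_
    rw [mul_comm, ← MvPolynomial.smul_eq_C_mul, smul_smul, mul_comm]
  simp only [e, aeval_rowComb_eq_ite hd hd1 hx h0]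
  have h := congrArg (fun a : ZMod p => a • truncate d x) (hu n Y)
  simp only [Finset.sum_smul, mul_smul, ite_smul, one_smul, zero_smul,
    rowsIndep_iff_det_ne_zero Y, ne_eq, ite_not] at h
  exact h

/-- Every nonzero homogeneous invariant without constant term generates powers of Moore
determinants under the Steenrod algebra. -/
theorem exists_mooreDet_pow_mem_span {x : MvPolynomial (Fin n) (ZMod p)}
    (hx : x ∈ augmentation p n) (hx0 : x ≠ 0) {m : ℕ} (hm : x.IsHomogeneous m) :
    ∃ K : ℕ, ∀ E : Fin n → ℕ, (∀ l, K ≤ E l) →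
      mooreDet p (ZMod p) E ^ (p - 1) ∈ Submodule.span (SteenrodAlgebra p) {x} := by
  obtain ⟨d, hd1, hd, hne, h0⟩ := exists_truncate x hx0 hx.2
  obtain ⟨ι, _, c, s, hs⟩ := exists_polynomial_eval_eq_ite hd hd1 hx.1 h0
  let A := MvPolynomial (Fin n) (ZMod p)
  -- The same combination with a generic matrix in place of `Y`; it can be evaluated both at
  -- matrices over `𝔽_p` and at truncated traces.
  let g : MvPolynomial (Fin n × Fin n) A := ∑ k, c k • MvPolynomial.aeval
    (fun i => ∑ l, MvPolynomial.C (s k l) * MvPolynomial.X (l, i)) x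
  have : CharP (MvPolynomial (Fin n) A) p :=
    charP_of_injective_algebraMap (algebraMap (ZMod p) (MvPolynomial (Fin n) A)).injective p
  have comp {T : Type _} [CommRing T] [Algebra (ZMod p) T] [Algebra A T]
      [IsScalarTower (ZMod p) A T] (f : Fin n × Fin n → T) :
      MvPolynomial.aeval f g = ∑ k, c k • MvPolynomial.aeval
        (fun i => ∑ l, algebraMap A T (s k l) * f (l, i)) x := by
    simp only [g, map_sum]
    refine Finset.sum_congr rfl fun k _ => ?_
    rw [← AlgHom.restrictScalars_apply (ZMod p), map_smul, ← AlgHom.comp_apply,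
      MvPolynomial.comp_aeval]
    simp
  obtain ⟨K, hK⟩ := exists_coeff_aeval_traceSum_eq (p := p) (S := MvPolynomial (Fin n) A) g
    (truncate d x) (fun Y => by
      rw [← hs Y, ← MvPolynomial.aeval_eq_eval, comp]
      rfl) MvPolynomial.X
  refine ⟨K, fun E hE => ?_⟩
  by_contra hmem
  let N := (Submodule.span (SteenrodAlgebra p) {x}).restrictScalars (ZMod p)
  -- A functional killing the cyclic submodule but not the Moore power. Applied to the coefficient
  -- identity it gives `truncate d x * ψ(Δ^(p-1)) = 0` in a domain, although both factors are
  -- nonzero.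
  obtain ⟨ψ, hψ, hker⟩ := Submodule.exists_le_ker_of_notMem (p := N) hmem
  have h1 := congrArg (extendFunctional A ψ) (hK E hE)
  have hzero (r : Fin n → A) (b) := extendFunctional_coeff_aeval_traceSum N
    (fun k f hf => by
      rw [← powerClass_smul]
      exact (Submodule.span (SteenrodAlgebra p) {x}).smul_mem (powerClass p k) hf)
    ψ (fun f hf => hker hf)
    (Submodule.mem_span_singleton_self x : x ∈ N) hm r E b
  rw [comp, MvPolynomial.coeff_sum, map_sum, Finset.sum_eq_zero, map_smul, smul_eq_mul] at h1
  · have e : (Matrix.of fun l i => MvPolynomial.X (R := A) i ^ p ^ E l).det ^ (p - 1) =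
        MvPolynomial.map (algebraMap (ZMod p) A) (mooreDet p (ZMod p) E ^ (p - 1)) := by
      rw [map_pow, map_mooreDet, mooreDet]
    rw [e, extendFunctional_map_algebraMap] at h1
    rcases mul_eq_zero.1 h1.symm with h | h
    · exact hne h
    · exact hψ ((map_eq_zero_iff _ (algebraMap (ZMod p) A).injective).1 h)
  · intro k _
    have hz := hzero (s k) ((p - 1) • ∑ l, Finsupp.single l (p ^ E l))
    rw [MvPolynomial.coeff_smul, ← algebraMap_smul A (c k), map_smul]
    exact (congrArg _ hz).trans (smul_zero _)

end Moore

/-! ### Invariants of low degree are determined by their values -/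

section LowDegree

variable {p : ℕ} [Fact p.Prime] {n : ℕ}

theorem aeval_rowComb_eq_of_rowsIndep {d : ℕ} (hd : d ≤ n) {A : Type*} [CommRing A]
    [Algebra (ZMod p) A] (t : Fin d → A) {x : MvPolynomial (Fin n) (ZMod p)}
    (hx : x ∈ invariants p n) {M M' : Matrix (Fin d) (Fin n) (ZMod p)} (hM : RowsIndep M)
    (hM' : RowsIndep M') :
    MvPolynomial.aeval (rowComb t M) x = MvPolynomial.aeval (rowComb t M') x := by
  obtain ⟨g, hg⟩ := hM.exists_mul_eq_truncMatrix hd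
  obtain ⟨g', hg'⟩ := hM'.exists_mul_eq_truncMatrix hd
  rw [← aeval_rowComb_mul t hx M g, ← aeval_rowComb_mul t hx M' g', hg, hg']

theorem aeval_linear_eq {A : Type*} [CommRing A] [Algebra (ZMod p) A] (v : Fin n → A)
    {x : MvPolynomial (Fin n) (ZMod p)} (hx : x ∈ invariants p n)
    {g : Matrix (Fin n) (Fin n) (ZMod p)} (hg : RowsIndep g) :
    MvPolynomial.aeval (fun j => ∑ i, g i j • v i) x = MvPolynomial.aeval v x := by
  have h := aeval_rowComb_eq_of_rowsIndep le_rfl v hx hg (M' := 1) (fun w hw => by simpa using hw)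
  have e : rowComb v (1 : Matrix (Fin n) (Fin n) (ZMod p)) = v := by
    funext i
    simp [rowComb, Matrix.one_apply]
  rw [e] at h
  exact h

/-- `GL_n` acts transitively on nonzero vectors, which are `1 × n` matrices with independent rows.
-/
theorem eval_eq_eval_of_ne_zero {x : MvPolynomial (Fin n) (ZMod p)} (hx : x ∈ invariants p n)
    {a b : Fin n → ZMod p} (ha : a ≠ 0) (hb : b ≠ 0) :
    MvPolynomial.eval a x = MvPolynomial.eval b x := by
  have hn : 1 ≤ n := by
    rcases n with _ | n
    · exact absurd (Subsingleton.elim a 0) ha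
    · omega
  have hr {a : Fin n → ZMod p} (ha : a ≠ 0) :
      RowsIndep (Matrix.of fun (_ : Fin 1) i => a i) := by
    intro w hw
    obtain ⟨i, hi⟩ := Function.ne_iff.1 ha
    have h := congrFun hw i
    simp only [Matrix.vecMul, dotProduct, Matrix.of_apply, Pi.zero_apply, Finset.univ_unique,
      Finset.sum_singleton] at h
    funext j
    rw [Subsingleton.elim j default]
    exact (mul_eq_zero.1 h).resolve_right hi
  have h := aeval_rowComb_eq_of_rowsIndep hn (fun _ => (1 : ZMod p)) hx (hr ha) (hr hb)
  have e (a : Fin n → ZMod p) :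
      rowComb (fun _ => (1 : ZMod p)) (Matrix.of fun (_ : Fin 1) i => a i) = a := by
    funext i
    simp [rowComb]
  rwa [e, e, MvPolynomial.aeval_eq_eval] at h

theorem finSuccEquiv_eq_aeval (x : MvPolynomial (Fin (n + 1)) (ZMod p)) :
    MvPolynomial.finSuccEquiv (ZMod p) n x = MvPolynomial.aeval
      (Fin.cases X fun i => C (MvPolynomial.X i)) x := by
  have h : (MvPolynomial.finSuccEquiv (ZMod p) n).toAlgHom =
      MvPolynomial.aeval (Fin.cases X fun i => C (MvPolynomial.X i)) := by
    apply MvPolynomial.algHom_ext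
    intro i
    refine Fin.cases ?_ (fun j => ?_) i
    · simp [MvPolynomial.finSuccEquiv_X_zero]
    · simp [MvPolynomial.finSuccEquiv_X_succ]
  exact DFunLike.congr_fun h x

/-- Invariance under `y_0 ↦ c y_0 + ∑ v_i y_(i+1)`. -/
theorem finSuccEquiv_comp_eq {x : MvPolynomial (Fin (n + 1)) (ZMod p)}
    (hx : x ∈ invariants p (n + 1)) {c : ZMod p} (hc : c ≠ 0) (v : Fin n → ZMod p) :
    (MvPolynomial.finSuccEquiv (ZMod p) n x).comp
        (C (MvPolynomial.C c) * X + C (∑ i, v i • MvPolynomial.X i)) =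
      MvPolynomial.finSuccEquiv (ZMod p) n x := by
  let g : Matrix (Fin (n + 1)) (Fin (n + 1)) (ZMod p) := Matrix.of fun i j =>
    (Fin.cases (Fin.cases c v i) (fun j' => if i = j'.succ then 1 else 0) j : ZMod p)
  have hg : RowsIndep g := by
    intro w hw
    have hs (j : Fin n) : w j.succ = 0 := by
      have := congrFun hw j.succ
      simpa [Matrix.vecMul, dotProduct, g] using this
    have h0 := congrFun hw 0
    simp only [Matrix.vecMul, dotProduct, g, Matrix.of_apply, Fin.cases_zero, Fin.sum_univ_succ,
      Fin.cases_succ, hs, zero_mul, Finset.sum_const_zero, add_zero, Pi.zero_apply] at h0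
    funext j
    refine Fin.cases ?_ hs j
    exact (mul_eq_zero.1 h0).resolve_right hc
  rw [finSuccEquiv_eq_aeval]
  conv_rhs => rw [← aeval_linear_eq _ hx hg]
  have e : ∀ P : (MvPolynomial (Fin n) (ZMod p))[X],
      P.comp (C (MvPolynomial.C c) * X + C (∑ i, v i • MvPolynomial.X i)) =
      (aeval (R := MvPolynomial (Fin n) (ZMod p))
        (C (MvPolynomial.C c) * X + C (∑ i, v i • MvPolynomial.X i)) :
        _ →ₐ[MvPolynomial (Fin n) (ZMod p)] _).restrictScalars (ZMod p) P := fun P => rfl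
  rw [e, ← AlgHom.comp_apply, MvPolynomial.comp_aeval]
  congr 2
  funext j
  refine Fin.cases ?_ (fun j => ?_) j
  · simp [g, Fin.sum_univ_succ, map_sum, Algebra.smul_def]
  · simp [g]

/-- Invariance under `y_(i+1) ↦ y_(i+1) + u_i y_0`. -/
theorem finSuccEquiv_eq_aeval_add {x : MvPolynomial (Fin (n + 1)) (ZMod p)}
    (hx : x ∈ invariants p (n + 1)) (u : Fin n → ZMod p) :
    MvPolynomial.aeval (Fin.cases X fun i => C (MvPolynomial.X i) + u i • X) x =
      MvPolynomial.finSuccEquiv (ZMod p) n x := by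
  let g : Matrix (Fin (n + 1)) (Fin (n + 1)) (ZMod p) := Matrix.of fun i j =>
    (Fin.cases (Fin.cases 1 u j) (fun i' => if j = i'.succ then 1 else 0) i : ZMod p)
  have hg : RowsIndep g := by
    intro w hw
    have h0 : w 0 = 0 := by
      have := congrFun hw 0
      simpa [Matrix.vecMul, dotProduct, g, Fin.sum_univ_succ, (Fin.succ_ne_zero _).symm] using this
    funext j
    refine Fin.cases h0 (fun j => ?_) j
    have := congrFun hw j.succ
    simpa [Matrix.vecMul, dotProduct, g, Fin.sum_univ_succ, h0] using this
  rw [finSuccEquiv_eq_aeval]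
  conv_rhs => rw [← aeval_linear_eq _ hx hg]
  congr 2
  funext j
  refine Fin.cases ?_ (fun j => ?_) j
  · simp [g, Fin.sum_univ_succ, (Fin.succ_ne_zero _).symm]
  · simp [g, Fin.sum_univ_succ, add_comm]

/-- First order Taylor expansion in `y_0` of `z(y_0, y' + u y_0)`. -/
theorem coeff_aeval_add_smul (u : Fin n → ZMod p) (z : MvPolynomial (Fin (n + 1)) (ZMod p)) :
    (MvPolynomial.aeval (Fin.cases X fun i => C (MvPolynomial.X i) + u i • X) z :
        (MvPolynomial (Fin n) (ZMod p))[X]).coeff 0 =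
      (MvPolynomial.finSuccEquiv (ZMod p) n z).coeff 0 ∧
    (MvPolynomial.aeval (Fin.cases X fun i => C (MvPolynomial.X i) + u i • X) z :
        (MvPolynomial (Fin n) (ZMod p))[X]).coeff 1 =
      (MvPolynomial.finSuccEquiv (ZMod p) n z).coeff 1 +
        ∑ i, u i • MvPolynomial.pderiv i ((MvPolynomial.finSuccEquiv (ZMod p) n z).coeff 0) := by
  induction z using MvPolynomial.induction_on with
  | C a =>
    have h1 : (MvPolynomial.finSuccEquiv (ZMod p) n (MvPolynomial.C a)) = C (MvPolynomial.C a) := by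
      simp [MvPolynomial.finSuccEquiv_apply]
    have h2 : (MvPolynomial.aeval (Fin.cases X fun i => C (MvPolynomial.X i) + u i • X)
        (MvPolynomial.C a) : (MvPolynomial (Fin n) (ZMod p))[X]) = C (MvPolynomial.C a) := by
      rw [MvPolynomial.algHom_C]; rfl
    rw [h1, h2]
    simp [coeff_C]
  | add f g hf hg =>
    simp only [map_add, coeff_add, hf.1, hf.2, hg.1, hg.2, smul_add, Finset.sum_add_distrib]
    exact ⟨trivial, by ring⟩
  | mul_X f i hf =>
    refine Fin.cases ?_ (fun j => ?_) i
    · simp [MvPolynomial.finSuccEquiv_X_zero, hf.1]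
    · have e1 : (MvPolynomial.aeval (Fin.cases X fun i => C (MvPolynomial.X i) + u i • X)
          (f * MvPolynomial.X j.succ) : (MvPolynomial (Fin n) (ZMod p))[X]) =
          MvPolynomial.aeval (Fin.cases X fun i => C (MvPolynomial.X i) + u i • X) f *
            C (MvPolynomial.X j) +
          u j • (MvPolynomial.aeval (Fin.cases X fun i => C (MvPolynomial.X i) + u i • X) f *
            X) := by
        rw [map_mul, MvPolynomial.aeval_X, Fin.cases_succ, mul_add, mul_smul_comm]
      have e2 : ∑ i, u i • MvPolynomial.pderiv i
          ((MvPolynomial.finSuccEquiv (ZMod p) n f).coeff 0 * MvPolynomial.X j) =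
          (∑ i, u i • MvPolynomial.pderiv i ((MvPolynomial.finSuccEquiv (ZMod p) n f).coeff 0)) *
            MvPolynomial.X j + u j • (MvPolynomial.finSuccEquiv (ZMod p) n f).coeff 0 := by
        simp only [Derivation.leibniz, MvPolynomial.pderiv_X, smul_eq_mul, smul_add,
          Finset.sum_add_distrib, Finset.sum_mul]
        rw [add_comm]
        congr 1
        · exact Finset.sum_congr rfl fun _ _ => by rw [smul_mul_assoc, mul_comm]
        · rw [Finset.sum_eq_single j]
          · simp
          · intro b _ hb
            simp [hb.symm]
          · simp
      rw [e1, map_mul, MvPolynomial.finSuccEquiv_X_succ]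
      simp only [coeff_add, coeff_mul_C, coeff_smul, coeff_mul_X_zero, smul_zero, add_zero, hf.1,
        hf.2, coeff_mul_X, true_and, e2]
      ring

/-- Invariance under the transvection `y_(i+1) ↦ y_(i+1) + y_0` makes the first order term of the
Taylor expansion vanish. -/
theorem pderiv_coeff_zero_finSuccEquiv {x : MvPolynomial (Fin (n + 1)) (ZMod p)}
    (hx : x ∈ invariants p (n + 1)) (i : Fin n) :
    MvPolynomial.pderiv i ((MvPolynomial.finSuccEquiv (ZMod p) n x).coeff 0) = 0 := by
  classical
  have h := (coeff_aeval_add_smul (Pi.single i 1) x).2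
  rw [finSuccEquiv_eq_aeval_add hx] at h
  simpa [Pi.single_apply, ite_smul] using h

/-- All exponents are divisible by `p`, and elements of `𝔽_p` are their own `p`-th powers. -/
theorem exists_pow_eq_of_pderiv_eq_zero {σ : Type*} {x : MvPolynomial σ (ZMod p)}
    (hx : ∀ i, MvPolynomial.pderiv i x = 0) : ∃ w, w ^ p = x := by
  have hp : p.Prime := Fact.out
  suffices h : x ∈ (MvPolynomial.expand p (R := ZMod p) (σ := σ)).range by
    obtain ⟨w, rfl⟩ := h
    exact ⟨w, (MvPolynomial.expand_zmod w).symm⟩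
  rw [x.as_sum]
  refine Subalgebra.sum_mem _ fun m hm => ?_
  have hdvd (i : σ) : p ∣ m i := by
    by_cases h0 : m i = 0
    · rw [h0]; exact dvd_zero p
    · have h := congrArg (MvPolynomial.coeff (m - Finsupp.single i 1)) (hx i)
      have e : m - Finsupp.single i 1 + Finsupp.single i 1 = m :=
        tsub_add_cancel_of_le (Finsupp.single_le_iff.2 (Nat.one_le_iff_ne_zero.2 h0))
      rw [MvPolynomial.coeff_pderiv, e, MvPolynomial.coeff_zero] at h
      have h1 := (mul_eq_zero.1 h).resolve_left (MvPolynomial.mem_support_iff.1 hm)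
      rw [Finsupp.tsub_apply, Finsupp.single_eq_same] at h1
      rw [← CharP.cast_eq_zero_iff (ZMod p) p, ← h1]
      norm_cast
      rw [Nat.sub_add_cancel (Nat.one_le_iff_ne_zero.2 h0)]
  refine ⟨MvPolynomial.monomial (m.mapRange (· / p) (Nat.zero_div p)) (MvPolynomial.coeff m x), ?_⟩
  change MvPolynomial.expand p _ = _
  rw [MvPolynomial.expand_monomial]
  have e : p • m.mapRange (· / p) (Nat.zero_div p) = m := by
    ext i
    simp only [Finsupp.smul_apply, Finsupp.mapRange_apply, smul_eq_mul]
    exact Nat.mul_div_cancel' (hdvd i)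
  rw [e]

/-- A change of the remaining variables after setting `y_0 = 0` evaluates `x` on the matrix `(0 |
h)`, and `x` has the same value on all `n × (n+1)` matrices of rank `n`. -/
theorem coeff_zero_finSuccEquiv_mem_invariants {x : MvPolynomial (Fin (n + 1)) (ZMod p)}
    (hx : x ∈ invariants p (n + 1)) :
    (MvPolynomial.finSuccEquiv (ZMod p) n x).coeff 0 ∈ invariants p n := by
  let M (h : Matrix (Fin n) (Fin n) (ZMod p)) : Matrix (Fin n) (Fin (n + 1)) (ZMod p) :=
    Matrix.of fun j i => Fin.cases 0 (h j) i
  have hM {h : Matrix (Fin n) (Fin n) (ZMod p)} (hh : RowsIndep h) : RowsIndep (M h) := by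
    intro w hw
    refine hh w (funext fun i => ?_)
    have := congrFun hw i.succ
    simpa [M, Matrix.vecMul, dotProduct] using this
  have hx0 : (MvPolynomial.finSuccEquiv (ZMod p) n x).coeff 0 =
      MvPolynomial.aeval (Fin.cases 0 MvPolynomial.X) x := by
    rw [finSuccEquiv_eq_aeval, coeff_zero_eq_aeval_zero,
      ← AlgHom.restrictScalars_apply (ZMod p), ← AlgHom.comp_apply, MvPolynomial.comp_aeval]
    congr 2
    funext i
    refine Fin.cases ?_ (fun j => ?_) i <;> simp
  have key (h : Matrix (Fin n) (Fin n) (ZMod p)) :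
      subst p n h (MvPolynomial.aeval (Fin.cases 0 MvPolynomial.X) x) =
        MvPolynomial.aeval (rowComb MvPolynomial.X (M h)) x := by
    rw [← AlgHom.comp_apply, MvPolynomial.comp_aeval]
    congr 2
    funext i
    refine Fin.cases ?_ (fun j => ?_) i
    · simp [M, rowComb]
    · simp [M, rowComb, subst]
  refine mem_invariants.2 fun g => ?_
  have h1 := aeval_rowComb_eq_of_rowsIndep (Nat.le_succ n)
    (MvPolynomial.X : Fin n → MvPolynomial (Fin n) (ZMod p)) hx
    (hM ((rowsIndep_iff_det_ne_zero _).2 (Matrix.GeneralLinearGroup.det_ne_zero g)))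
    (hM ((rowsIndep_iff_det_ne_zero 1).2 (by simp)))
  rw [hx0, key, h1, ← key]
  simp [subst, Matrix.one_apply]

theorem isHomogeneous_of_pow {σ : Type*} {w : MvPolynomial σ (ZMod p)} {m : ℕ}
    (h : (w ^ p).IsHomogeneous m) : w.IsHomogeneous (m / p) := by
  have hp : p.Prime := Fact.out
  intro k hk
  rw [← MvPolynomial.expand_zmod] at h
  have h1 := h (d := p • k) (by rwa [MvPolynomial.coeff_expand_smul _ hp.ne_zero])
  rw [map_nsmul, smul_eq_mul] at h1
  rw [← h1, Nat.mul_div_cancel_left _ hp.pos]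

theorem mem_invariants_of_pow_mem {w : MvPolynomial (Fin n) (ZMod p)}
    (h : w ^ p ∈ invariants p n) : w ∈ invariants p n := by
  refine mem_invariants.2 fun g => ?_
  have h1 := mem_invariants.1 h g
  rw [map_pow] at h1
  exact frobenius_inj (MvPolynomial (Fin n) (ZMod p)) p h1

/-- Invariance under `y_0 ↦ c y_0` leaves only powers of `y_0` whose exponent is divisible by `p -
1`. -/
theorem X_pow_dvd_finSuccEquiv {x : MvPolynomial (Fin (n + 1)) (ZMod p)}
    (hx : x ∈ invariants p (n + 1)) (h0 : (MvPolynomial.finSuccEquiv (ZMod p) n x).coeff 0 = 0) :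
    X ^ (p - 1) ∣ MvPolynomial.finSuccEquiv (ZMod p) n x := by
  rw [X_pow_dvd_iff]
  intro i hi
  by_contra hne
  have hi0 : i ≠ 0 := by
    rintro rfl
    exact hne h0
  have hall : ∀ c : (ZMod p)ˣ, c ^ i = 1 := by
    intro c
    have h := congrArg (fun P => P.coeff i) (finSuccEquiv_comp_eq hx c.ne_zero 0)
    simp only [Pi.zero_apply, zero_smul, Finset.sum_const_zero, map_zero, add_zero,
      comp_C_mul_X_coeff] at h
    have h1 := mul_left_cancel₀ hne (h.trans (mul_one _).symm)
    rw [← map_pow, ← map_one MvPolynomial.C] at h1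
    exact Units.ext (by simpa using MvPolynomial.C_injective _ _ h1)
  rw [FiniteField.forall_pow_eq_one_iff, ZMod.card] at hall
  exact absurd (Nat.le_of_dvd (Nat.pos_of_ne_zero hi0) hall) (by omega)

/-- As a polynomial in `y_0`, `x` is invariant under translation by the `p^n` linear forms in the
other variables. Each translate of the root `0` is thus a root of multiplicity at least `p - 1`. -/
theorem le_natDegree_finSuccEquiv {x : MvPolynomial (Fin (n + 1)) (ZMod p)}
    (hx : x ∈ invariants p (n + 1)) (hx0 : x ≠ 0)
    (h0 : (MvPolynomial.finSuccEquiv (ZMod p) n x).coeff 0 = 0) :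
    p ^ n * (p - 1) ≤ (MvPolynomial.finSuccEquiv (ZMod p) n x).natDegree := by
  classical
  set P := MvPolynomial.finSuccEquiv (ZMod p) n x with hP
  have hP0 : P ≠ 0 := by rwa [hP, Ne, EmbeddingLike.map_eq_zero_iff]
  let ℓ : (Fin n → ZMod p) → MvPolynomial (Fin n) (ZMod p) := fun v =>
    -∑ i, v i • MvPolynomial.X i
  have hinj : Function.Injective ℓ := by
    intro v v' h
    funext i
    have h1 := congrArg (MvPolynomial.coeff (Finsupp.single i 1)) (neg_injective h)
    simpa [MvPolynomial.coeff_sum, MvPolynomial.coeff_smul, MvPolynomial.coeff_X,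
      Finsupp.single_left_inj, MvPolynomial.coeff_X] using h1
  have hcount (v : Fin n → ZMod p) : p - 1 ≤ P.roots.count (ℓ v) := by
    rw [count_roots, le_rootMultiplicity_iff hP0]
    obtain ⟨Q, hQ⟩ := X_pow_dvd_finSuccEquiv hx h0
    refine ⟨Q.comp (C (MvPolynomial.C 1) * X + C (∑ i, v i • MvPolynomial.X i)), ?_⟩
    have h := finSuccEquiv_comp_eq hx one_ne_zero v
    rw [← hP] at h hQ
    conv_lhs => rw [← h, hQ]
    rw [mul_comp, pow_comp, X_comp]
    simp [ℓ]
  calc p ^ n * (p - 1) = ∑ _v : Fin n → ZMod p, (p - 1) := by simp [ZMod.card]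
    _ ≤ ∑ v : Fin n → ZMod p, P.roots.count (ℓ v) := Finset.sum_le_sum fun v _ => hcount v
    _ = ∑ a ∈ Finset.univ.image ℓ, P.roots.count a := by
      rw [Finset.sum_image fun v _ v' _ h => hinj h]
    _ ≤ ∑ a ∈ Finset.univ.image ℓ ∪ P.roots.toFinset, P.roots.count a :=
      Finset.sum_le_sum_of_subset Finset.subset_union_left
    _ = P.roots.card := Multiset.sum_count_eq_card fun a ha =>
      Finset.mem_union_right _ (Multiset.mem_toFinset.2 ha)
    _ ≤ P.natDegree := card_roots' P

/-- Homogeneous invariants of degree at most `p^n - p^(n-1)` are determined by their values on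
`𝔽_p^n`. -/
theorem eq_zero_of_eval_eq_zero (hn : 1 ≤ n) {x : MvPolynomial (Fin n) (ZMod p)}
    (hx : x ∈ invariants p n) {m : ℕ} (hm : x.IsHomogeneous m) (hle : m ≤ p ^ n - p ^ (n - 1))
    (h : ∀ a, MvPolynomial.eval a x = 0) : x = 0 := by
  have hp : p.Prime := Fact.out
  induction n generalizing m with
  | zero => omega
  | succ n ih =>
    have heval (a : Fin n → ZMod p) :
        MvPolynomial.eval a ((MvPolynomial.finSuccEquiv (ZMod p) n x).coeff 0) = 0 := by
      have h1 := h (Fin.cons 0 a)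
      rw [MvPolynomial.eval_eq_eval_mv_eval', ← coeff_zero_eq_eval_zero, coeff_map] at h1
      exact h1
    -- The restriction to `y_0 = 0` is `w^p` with `w` an invariant in `n` variables vanishing at all
    -- points. Division by `p` carries the bound `p^(n+1) - p^n` to `p^n - p^(n-1)`, so induction
    -- gives `w = 0`. For `n = 0` the restriction is a constant, and its value is zero.
    have h0 : (MvPolynomial.finSuccEquiv (ZMod p) n x).coeff 0 = 0 := by
      rcases Nat.eq_zero_or_pos n with rfl | hn'
      · have h1 := heval 0
        rw [MvPolynomial.eq_C_of_isEmpty ((MvPolynomial.finSuccEquiv (ZMod p) 0 x).coeff 0)]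
          at h1 ⊢
        rw [MvPolynomial.eval_C] at h1
        rw [h1, map_zero]
      · obtain ⟨w, hw⟩ := exists_pow_eq_of_pderiv_eq_zero (pderiv_coeff_zero_finSuccEquiv hx)
        have hinv := coeff_zero_finSuccEquiv_mem_invariants hx
        have hhom := hm.finSuccEquiv_coeff_isHomogeneous 0 m (zero_add m)
        rw [← hw] at hinv hhom heval ⊢
        rw [ih hn' (mem_invariants_of_pow_mem hinv) (isHomogeneous_of_pow hhom) ?_ ?_,
          zero_pow hp.ne_zero]
        · refine Nat.div_le_of_le_mul ?_
          rw [Nat.mul_sub, ← pow_succ', ← pow_succ', Nat.sub_add_cancel hn']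
          exact hle
        · intro a
          have := heval a
          rw [map_pow] at this
          exact pow_eq_zero_iff hp.ne_zero |>.1 this
    by_contra hx0
    have h1 := le_natDegree_finSuccEquiv hx hx0 h0
    have h2 : (MvPolynomial.finSuccEquiv (ZMod p) n x).natDegree ≤ m := by
      rw [MvPolynomial.natDegree_finSuccEquiv]
      exact (MvPolynomial.degreeOf_le_totalDegree x 0).trans hm.totalDegree_le
    have h3 : p ^ n * (p - 1) = p ^ (n + 1) - p ^ (n + 1 - 1) := by
      rw [Nat.mul_sub, mul_one, ← pow_succ, Nat.add_sub_cancel]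
    -- The degree in `y_0` reaches the total degree, so the leading coefficient in `y_0` is a
    -- constant. It equals the value of `x` at `(1, 0, …, 0)`, which is zero.
    have h4 : (MvPolynomial.finSuccEquiv (ZMod p) n x).natDegree = m := by omega
    have h5 := h (Fin.cons 1 0)
    rw [MvPolynomial.eval_eq_eval_mv_eval', eval_eq_sum_range' (n := m + 1)
      ((natDegree_map_le).trans_lt (by omega)), Finset.sum_eq_single m] at h5
    · rw [one_pow, mul_one, coeff_map] at h5
      have h6 := MvPolynomial.totalDegree_eq_zero_iff_eq_C.1 (Nat.le_zero.1
        (hm.finSuccEquiv_coeff_isHomogeneous m 0 (add_zero m)).totalDegree_le)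
      rw [h6, MvPolynomial.eval_C] at h5
      rw [h5, map_zero, ← h4, coeff_natDegree, leadingCoeff_eq_zero,
        EmbeddingLike.map_eq_zero_iff] at h6
      exact hx0 h6
    · intro i hi hne
      have hi' : i < m := lt_of_le_of_ne (Nat.lt_succ_iff.1 (Finset.mem_range.1 hi)) hne
      have h6 := (hm.finSuccEquiv_coeff_isHomogeneous i (m - i) (by omega)).coeff_eq_zero
        (d := 0) (by simp; omega)
      rw [coeff_map, one_pow, mul_one, MvPolynomial.eval_zero]
      exact h6
    · intro hm'
      exact absurd (Finset.mem_range.2 (Nat.lt_succ_self m)) hm'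

end LowDegree

/-! ### Homogeneous components -/

section Grading

theorem genDegree_pos (p : ℕ) : 0 < genDegree p := by
  unfold genDegree
  split_ifs <;> omega

variable {p : ℕ} [Fact p.Prime] {n : ℕ}

theorem coeff_prod_X_sub_C_isHomogeneous {σ ι R : Type*} [CommRing R] (ℓ : ι → MvPolynomial σ R)
    (hℓ : ∀ v, (ℓ v).IsHomogeneous 1) (s : Finset ι) (k : ℕ) :
    (∀ j, k + j = s.card → ((∏ v ∈ s, (X - C (ℓ v))).coeff k).IsHomogeneous j) ∧
      (s.card < k → (∏ v ∈ s, (X - C (ℓ v))).coeff k = 0) := by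
  classical
  induction s using Finset.induction_on generalizing k with
  | empty =>
    rw [Finset.prod_empty, Finset.card_empty]
    refine ⟨fun j hj => ?_, fun hk => ?_⟩
    · obtain ⟨rfl, rfl⟩ : k = 0 ∧ j = 0 := by omega
      rw [coeff_one_zero]
      exact MvPolynomial.isHomogeneous_one _ _
    · rw [coeff_one, if_neg (by omega)]
  | insert a s ha ih =>
    rw [Finset.prod_insert ha, Finset.card_insert_of_notMem ha, sub_mul]
    rcases k with _ | k
    · refine ⟨fun j hj => ?_, fun hk => by omega⟩
      rw [coeff_sub, coeff_X_mul_zero, coeff_C_mul, zero_sub]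
      have := (hℓ a).mul ((ih 0).1 s.card (zero_add _))
      rw [show j = 1 + s.card by omega]
      exact this.neg
    · rw [coeff_sub, coeff_X_mul, coeff_C_mul]
      refine ⟨fun j hj => ?_, fun hk => ?_⟩
      · refine ((ih k).1 j (by omega)).sub ?_
        rcases j with _ | j
        · rw [(ih (k + 1)).2 (by omega), mul_zero]
          exact MvPolynomial.isHomogeneous_zero _ _ _
        · rw [add_comm j 1]
          exact (hℓ a).mul ((ih (k + 1)).1 j (by omega))
      · rw [(ih k).2 (by omega), (ih (k + 1)).2 (by omega), mul_zero, sub_zero]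

theorem linearForm_isHomogeneous (v : Fin n → ZMod p) :
    (∑ i, v i • MvPolynomial.X (R := ZMod p) i).IsHomogeneous 1 :=
  MvPolynomial.IsHomogeneous.sum _ _ _ fun i _ => by
    rw [MvPolynomial.smul_eq_C_mul]
    exact (MvPolynomial.isHomogeneous_X _ i).C_mul _

theorem dicksonInvariant_isHomogeneous (i : ℕ) :
    (dicksonInvariant p n i).IsHomogeneous (p ^ n - p ^ (n - i)) := by
  have hle : p ^ (n - i) ≤ p ^ n :=
    Nat.pow_le_pow_right (Fact.out : p.Prime).pos (Nat.sub_le n i)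
  have h := (coeff_prod_X_sub_C_isHomogeneous _ (linearForm_isHomogeneous (p := p) (n := n))
    Finset.univ (p ^ (n - i))).1 (p ^ n - p ^ (n - i)) (by
      rw [Finset.card_univ, Fintype.card_fun, ZMod.card, Fintype.card_fin]
      omega)
  have e : (-1 : MvPolynomial (Fin n) (ZMod p)) ^ i = MvPolynomial.C ((-1) ^ i) := by simp
  rw [dicksonInvariant, e]
  exact h.C_mul _

theorem homogeneousComponent_mem_invariants {x : MvPolynomial (Fin n) (ZMod p)}
    (hx : x ∈ invariants p n) (m : ℕ) :
    MvPolynomial.homogeneousComponent m x ∈ invariants p n := by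
  refine mem_invariants.2 fun g => ?_
  have hom (k : ℕ) : (subst p n g (MvPolynomial.homogeneousComponent k x)).IsHomogeneous k := by
    have := (MvPolynomial.homogeneousComponent_isHomogeneous k x).aeval
      (fun j => ∑ i, (g : Matrix (Fin n) (Fin n) (ZMod p)) i j • MvPolynomial.X (R := ZMod p) i)
      (n := 1) fun j => linearForm_isHomogeneous _
    rwa [one_mul] at this
  conv_rhs => rw [← mem_invariants.1 hx g]
  conv_rhs => rw [← MvPolynomial.sum_homogeneousComponent x]
  rw [map_sum, map_sum]
  simp only [MvPolynomial.homogeneousComponent_of_mem (hom _)]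
  rw [Finset.sum_ite_eq]
  split_ifs with h
  · rfl
  · rw [MvPolynomial.homogeneousComponent_eq_zero _ _ (by simpa [Nat.lt_succ_iff] using h),
      map_zero]

theorem weight_const (c : ℕ) (d : Fin n →₀ ℕ) :
    Finsupp.weight (fun _ : Fin n => c) d = c * Finsupp.weight 1 d := by
  simp [Finsupp.weight_apply, Finsupp.sum, Finset.mul_sum, mul_comm]

theorem mem_component_iff {N : Submodule (SteenrodAlgebra p) (MvPolynomial (Fin n) (ZMod p))}
    {x : N} {m : ℕ} : x ∈ component p n N (genDegree p * m) ↔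
      (x : MvPolynomial (Fin n) (ZMod p)).IsHomogeneous m := by
  change (∀ ⦃d⦄, _ → Finsupp.weight _ d = _) ↔ (∀ ⦃d⦄, _ → Finsupp.weight 1 d = m)
  simp only [weight_const, Nat.mul_right_inj (genDegree_pos p).ne']
  rfl

theorem exists_isHomogeneous_of_mem_component
    {N : Submodule (SteenrodAlgebra p) (MvPolynomial (Fin n) (ZMod p))} {x : N} {i : ℕ}
    (hx : x ∈ component p n N i) (hx0 : x ≠ 0) : ∃ m, i = genDegree p * m := by
  obtain ⟨d, hd⟩ := MvPolynomial.ne_zero_iff.1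
    (fun h => hx0 (Subtype.ext h) : (x : MvPolynomial (Fin n) (ZMod p)) ≠ 0)
  have h : Finsupp.weight (fun _ => genDegree p) d = i := hx hd
  exact ⟨_, h.symm.trans (weight_const _ d)⟩

theorem finite_isHomogeneous (m : ℕ) :
    {x : MvPolynomial (Fin n) (ZMod p) | x.IsHomogeneous m}.Finite := by
  have h := MvPolynomial.weightedHomogeneousSubmodule_fg (σ := Fin n) (R := ZMod p) 1
    (fun _ => one_ne_zero) m
  have : Module.Finite (ZMod p)
    (MvPolynomial.weightedHomogeneousSubmodule (ZMod p) (1 : Fin n → ℕ) m) :=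
      Module.Finite.iff_fg.2 h
  have : Finite (MvPolynomial.weightedHomogeneousSubmodule (ZMod p) (1 : Fin n → ℕ) m) :=
    Module.finite_of_finite (ZMod p)
  exact Set.toFinite (MvPolynomial.weightedHomogeneousSubmodule (ZMod p) (1 : Fin n → ℕ) m :
    Set (MvPolynomial (Fin n) (ZMod p)))

end Grading

/-! ### Maps of degree zero and common multiples -/

section DegreeZero

variable {p : ℕ} [Fact p.Prime] {n : ℕ}
  {N : Submodule (SteenrodAlgebra p) (MvPolynomial (Fin n) (ZMod p))}
  {f : N →ₗ[SteenrodAlgebra p] N}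

theorem sum_homogeneousComponent_subtype
    (hN : ∀ x ∈ N, ∀ m, MvPolynomial.homogeneousComponent m x ∈ N) (x : N) :
    x = ∑ m ∈ Finset.range ((x : MvPolynomial (Fin n) (ZMod p)).totalDegree + 1),
      (⟨MvPolynomial.homogeneousComponent m x, hN x x.2 m⟩ : N) := by
  apply Subtype.ext
  rw [Submodule.coe_sum]
  exact (MvPolynomial.sum_homogeneousComponent _).symm

theorem homogeneousComponent_apply (hf : IsDegreeZero (component p n N) f)
    (hN : ∀ x ∈ N, ∀ m, MvPolynomial.homogeneousComponent m x ∈ N) (x : N) (m : ℕ) :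
    MvPolynomial.homogeneousComponent m (f x : MvPolynomial (Fin n) (ZMod p)) =
      f ⟨MvPolynomial.homogeneousComponent m x, hN x x.2 m⟩ := by
  have hom (k : ℕ) : (f ⟨MvPolynomial.homogeneousComponent k x, hN x x.2 k⟩ :
      MvPolynomial (Fin n) (ZMod p)).IsHomogeneous k :=
    mem_component_iff.1 (hf _ _ (mem_component_iff.2
      (MvPolynomial.homogeneousComponent_isHomogeneous k _)))
  conv_lhs => rw [sum_homogeneousComponent_subtype hN x]
  rw [map_sum, Submodule.coe_sum, map_sum]
  simp only [MvPolynomial.homogeneousComponent_of_mem (hom _)]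
  rw [Finset.sum_ite_eq]
  split_ifs with h
  · rfl
  · have e : (⟨MvPolynomial.homogeneousComponent m x, hN x x.2 m⟩ : N) = 0 :=
      Subtype.ext (MvPolynomial.homogeneousComponent_eq_zero _ _ (by
        simpa [Nat.lt_succ_iff] using h))
    rw [e, map_zero]
    rfl

theorem constantCoeff_apply (hf : IsDegreeZero (component p n N) f)
    (hN : ∀ x ∈ N, ∀ m, MvPolynomial.homogeneousComponent m x ∈ N) (x : N)
    (hx : MvPolynomial.constantCoeff (x : MvPolynomial (Fin n) (ZMod p)) = 0) :
    MvPolynomial.constantCoeff (f x : MvPolynomial (Fin n) (ZMod p)) = 0 := by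
  have h := homogeneousComponent_apply hf hN x 0
  have h0 : MvPolynomial.homogeneousComponent 0 (x : MvPolynomial (Fin n) (ZMod p)) = 0 := by
    rw [MvPolynomial.homogeneousComponent_zero, ← MvPolynomial.constantCoeff_eq, hx, map_zero]
  have e : (⟨MvPolynomial.homogeneousComponent 0 x, hN x x.2 0⟩ : N) = 0 := Subtype.ext h0
  rw [e, map_zero, MvPolynomial.homogeneousComponent_zero, ← MvPolynomial.constantCoeff_eq] at h
  exact (map_eq_zero_iff _ (MvPolynomial.C_injective _ _)).1 h

theorem constantCoeff_homogeneousComponent {x : MvPolynomial (Fin n) (ZMod p)}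
    (hx : MvPolynomial.constantCoeff x = 0) (m : ℕ) :
    MvPolynomial.constantCoeff (MvPolynomial.homogeneousComponent m x) = 0 := by
  classical
  rw [MvPolynomial.constantCoeff_eq, MvPolynomial.coeff_homogeneousComponent]
  split_ifs
  · exact hx
  · rfl

theorem apply_sub_eq_zero {x y : N} (h : f x = f y) : f (x - y) = 0 := by
  have h' : f (x - y + y) = f (x - y) + f y := map_add f _ _
  rw [show x - y + y = x from Subtype.ext (sub_add_cancel (x : MvPolynomial (Fin n) (ZMod p)) y),
    h] at h'
  exact left_eq_add.1 ((add_comm _ _).trans h'.symm).symm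

theorem apply_zmod_smul (c : ZMod p) (x : N) : f (c • x) = c • f x :=
  ZMod.map_smul f.toAddMonoidHom c x

theorem eq_of_sub_eq_zero {x y : N} (h : x - y = 0) : x = y :=
  Subtype.ext (sub_eq_zero.1 (congrArg Subtype.val h))

/-- A degree zero self-map which is injective on homogeneous elements without constant term is
bijective on elements without constant term. -/
theorem bijOn_of_injective_homogeneous (hf : IsDegreeZero (component p n N) f)
    (hN : ∀ x ∈ N, ∀ m, MvPolynomial.homogeneousComponent m x ∈ N)
    (hinj : ∀ (m : ℕ) (x : N), (x : MvPolynomial (Fin n) (ZMod p)).IsHomogeneous m →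
      MvPolynomial.constantCoeff (x : MvPolynomial (Fin n) (ZMod p)) = 0 → f x = 0 → x = 0) :
    Set.BijOn f {x | MvPolynomial.constantCoeff (x : MvPolynomial (Fin n) (ZMod p)) = 0}
      {x | MvPolynomial.constantCoeff (x : MvPolynomial (Fin n) (ZMod p)) = 0} := by
  refine ⟨fun x hx => constantCoeff_apply hf hN x hx, fun x hx y hy hxy => ?_, fun y hy => ?_⟩
  · apply eq_of_sub_eq_zero
    have hz : f (x - y) = 0 := apply_sub_eq_zero hxy
    have hc : MvPolynomial.constantCoeff ((x - y : N) : MvPolynomial (Fin n) (ZMod p)) = 0 := by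
      rw [AddSubgroupClass.coe_sub, map_sub, hx, hy, sub_self]
    rw [sum_homogeneousComponent_subtype hN (x - y)]
    refine Finset.sum_eq_zero fun m _ => hinj m _
      (MvPolynomial.homogeneousComponent_isHomogeneous m _)
      (constantCoeff_homogeneousComponent hc m) (Subtype.ext ?_)
    rw [← homogeneousComponent_apply hf hN, hz]
    exact map_zero _
  · have step (m : ℕ) : ∃ x : N, MvPolynomial.constantCoeff (x : MvPolynomial (Fin n) (ZMod p)) = 0
        ∧ f x = ⟨MvPolynomial.homogeneousComponent m y, hN y y.2 m⟩ := by
      -- A finite set preserved by `f`: injectivity on it implies surjectivity.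
      let T : Set N := {x | (x : MvPolynomial (Fin n) (ZMod p)).IsHomogeneous m ∧
        MvPolynomial.constantCoeff (x : MvPolynomial (Fin n) (ZMod p)) = 0}
      have hT : T.Finite := ((finite_isHomogeneous m).preimage
        Subtype.val_injective.injOn).subset fun x hx => hx.1
      have hmaps : Set.MapsTo f T T := fun x hx =>
        ⟨mem_component_iff.1 (hf _ _ (mem_component_iff.2 hx.1)), constantCoeff_apply hf hN x hx.2⟩
      have hinjT : Set.InjOn f T := fun x hx x' hx' h => by
        refine eq_of_sub_eq_zero (hinj m _ (hx.1.sub hx'.1) ?_ (apply_sub_eq_zero h))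
        rw [AddSubgroupClass.coe_sub, map_sub, hx.2, hx'.2, sub_self]
      obtain ⟨x, hx, hfx⟩ := (Set.Finite.injOn_iff_bijOn_of_mapsTo hT hmaps).1 hinjT |>.surjOn
        (show (⟨MvPolynomial.homogeneousComponent m y, hN y y.2 m⟩ : N) ∈ T from
          ⟨MvPolynomial.homogeneousComponent_isHomogeneous m _,
            constantCoeff_homogeneousComponent hy m⟩)
      exact ⟨x, hx.2, hfx⟩
    choose x hx hfx using step
    refine ⟨∑ m ∈ Finset.range ((y : MvPolynomial (Fin n) (ZMod p)).totalDegree + 1), x m, ?_, ?_⟩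
    · rw [Set.mem_ofPred_eq, Submodule.coe_sum, map_sum]
      exact Finset.sum_eq_zero fun m _ => hx m
    · rw [map_sum]
      simp only [hfx]
      exact (sum_homogeneousComponent_subtype hN y).symm

/-- Nonzero homogeneous elements of the augmentation ideal have a common nonzero multiple. -/
theorem exists_smul_eq_smul {x w : MvPolynomial (Fin n) (ZMod p)} (hx : x ∈ augmentation p n)
    (hx0 : x ≠ 0) {m : ℕ} (hm : x.IsHomogeneous m) (hw : w ∈ augmentation p n)
    (hw0 : w ≠ 0) {m' : ℕ} (hm' : w.IsHomogeneous m') :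
    ∃ a b : SteenrodAlgebra p, a • x = b • w ∧ a • x ≠ 0 := by
  obtain ⟨K, hK⟩ := exists_mooreDet_pow_mem_span hx hx0 hm
  obtain ⟨K', hK'⟩ := exists_mooreDet_pow_mem_span hw hw0 hm'
  -- Exponents beyond both thresholds, and pairwise distinct so that the Moore determinant is
  -- nonzero.
  let E : Fin n → ℕ := fun l => max K K' + l
  obtain ⟨a, ha⟩ := Submodule.mem_span_singleton.1
    (hK E fun l => (le_max_left K K').trans (Nat.le_add_right _ _))
  obtain ⟨b, hb⟩ := Submodule.mem_span_singleton.1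
    (hK' E fun l => (le_max_right K K').trans (Nat.le_add_right _ _))
  refine ⟨a, b, ha.trans hb.symm, ?_⟩
  rw [ha]
  exact pow_ne_zero _ (mooreDet_ne_zero fun l l' h => Fin.ext (Nat.add_left_cancel h))

theorem homogeneousComponent_mem_dickson {x : MvPolynomial (Fin n) (ZMod p)}
    (hx : x ∈ dickson p n) (m : ℕ) : MvPolynomial.homogeneousComponent m x ∈ dickson p n :=
  homogeneousComponent_mem_invariants hx m

theorem homogeneousComponent_mem_augmentation {x : MvPolynomial (Fin n) (ZMod p)}
    (hx : x ∈ augmentation p n) (m : ℕ) :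
    MvPolynomial.homogeneousComponent m x ∈ augmentation p n :=
  ⟨homogeneousComponent_mem_dickson hx.1 m, constantCoeff_homogeneousComponent hx.2 m⟩

/-- The lowest positive degree of the Dickson algebra is spanned by `d_{n,1}`. -/
theorem exists_nsmul_dicksonInvariant_one (hn : 1 ≤ n) {w : MvPolynomial (Fin n) (ZMod p)}
    (hw : w ∈ dickson p n) (hm : w.IsHomogeneous (p ^ n - p ^ (n - 1)))
    (hd : dicksonInvariant p n 1 ≠ 0) : ∃ k : ℕ, w = k • dicksonInvariant p n 1 := by
  have hp : p.Prime := Fact.out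
  have hlt : p ^ (n - 1) < p ^ n := Nat.pow_lt_pow_right hp.one_lt (by omega)
  have hdm := dicksonInvariant_isHomogeneous (p := p) (n := n) 1
  have hdi : dicksonInvariant p n 1 ∈ invariants p n := dicksonInvariant_mem 1
  let a₀ : Fin n → ZMod p := fun _ => 1
  have ha₀ : a₀ ≠ 0 := fun h => one_ne_zero (congrFun h ⟨0, hn⟩)
  -- An invariant takes a single value on all nonzero vectors, and a homogeneous one of positive
  -- degree vanishes at the origin. One value therefore decides whether an invariant of this degree
  -- is zero, which makes the space at most one-dimensional.
  have vanish {y : MvPolynomial (Fin n) (ZMod p)} (hy : y ∈ invariants p n)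
      (hym : y.IsHomogeneous (p ^ n - p ^ (n - 1))) (h0 : MvPolynomial.eval a₀ y = 0) : y = 0 := by
    refine eq_zero_of_eval_eq_zero hn hy hym le_rfl fun a => ?_
    by_cases ha : a = 0
    · rw [ha, MvPolynomial.eval_zero, MvPolynomial.constantCoeff_eq]
      exact hym.coeff_eq_zero (by rw [map_zero]; omega)
    · rw [eval_eq_eval_of_ne_zero hy ha ha₀, h0]
  have hev : MvPolynomial.eval a₀ (dicksonInvariant p n 1) ≠ 0 := fun h => hd (vanish hdi hdm h)
  set c := MvPolynomial.eval a₀ w / MvPolynomial.eval a₀ (dicksonInvariant p n 1) with hc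
  -- The scalar is lifted to `ℕ`, since natural multiples commute with the action of every Steenrod
  -- operation.
  refine ⟨c.val, ?_⟩
  have h := vanish (y := w - c • dicksonInvariant p n 1)
    (sub_mem hw ((invariants p n).smul_mem hdi c))
    (hm.sub (by rw [MvPolynomial.smul_eq_C_mul]; exact hdm.C_mul c))
    (by rw [map_sub, MvPolynomial.smul_eval, hc, div_mul_cancel₀ _ hev, sub_self])
  rw [sub_eq_zero] at h
  rw [h, ← Nat.cast_smul_eq_nsmul (ZMod p), ZMod.natCast_zmod_val]

end DegreeZero

/-! ### Self-maps of the Dickson algebra and atomicity -/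

section Main

variable {p : ℕ} [Fact p.Prime] {n : ℕ}

theorem bijOn_augmentation (hn : 1 ≤ n) (f : dickson p n →ₗ[SteenrodAlgebra p] dickson p n)
    (hf : IsDegreeZero (component p n (dickson p n)) f)
    (hfd : f ⟨dicksonInvariant p n 1, dicksonInvariant_mem 1⟩ ≠ 0) :
    Set.BijOn f {x | MvPolynomial.constantCoeff (x : MvPolynomial (Fin n) (ZMod p)) = 0}
      {x | MvPolynomial.constantCoeff (x : MvPolynomial (Fin n) (ZMod p)) = 0} := by
  have hp : p.Prime := Fact.out
  have hlt : p ^ (n - 1) < p ^ n := Nat.pow_lt_pow_right hp.one_lt (by omega)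
  refine bijOn_of_injective_homogeneous hf (fun x hx m => homogeneousComponent_mem_dickson hx m)
    fun m x hm hc hfx => by_contra fun hx0 => ?_
  set d : dickson p n := ⟨dicksonInvariant p n 1, dicksonInvariant_mem 1⟩ with hd
  have hdm := dicksonInvariant_isHomogeneous (p := p) (n := n) 1
  have hd0 : dicksonInvariant p n 1 ≠ 0 := fun h => hfd (by
    have : d = 0 := Subtype.ext h
    rw [this, map_zero])
  have hdc : dicksonInvariant p n 1 ∈ augmentation p n := ⟨dicksonInvariant_mem 1, by
    rw [MvPolynomial.constantCoeff_eq]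
    exact hdm.coeff_eq_zero (by rw [map_zero]; omega)⟩
  obtain ⟨k, hk⟩ := exists_nsmul_dicksonInvariant_one hn (f d).2
    (mem_component_iff.1 (hf _ d (mem_component_iff.2 hdm))) hd0
  have hk' : f d = k • d := Subtype.ext hk
  -- If `f` kills `x`, it kills `a • x = b • d`; but `f (b • d)` is `k • (a • x)`, which is nonzero
  -- because `k` is nonzero modulo `p`.
  obtain ⟨a, b, hab, hne⟩ := exists_smul_eq_smul (x := x) ⟨x.2, hc⟩
    (fun h => hx0 (Subtype.ext h)) hm hdc hd0 hdm
  have hab' : a • x = b • d := Subtype.ext hab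
  have h1 : f (b • d) = 0 := by rw [← hab', map_smul, hfx, smul_zero]
  rw [map_smul, hk', smul_comm, ← hab'] at h1
  have h2 : (k : ZMod p) • (a • (x : MvPolynomial (Fin n) (ZMod p))) = 0 := by
    rw [Nat.cast_smul_eq_nsmul]
    exact congrArg Subtype.val h1
  rcases smul_eq_zero.1 h2 with h3 | h3
  · apply hfd
    rw [hk']
    apply Subtype.ext
    change k • dicksonInvariant p n 1 = 0
    rw [← Nat.cast_smul_eq_nsmul (ZMod p), h3, zero_smul]
  · exact hne h3

/-- The algebra is the direct sum of the constants and the augmentation ideal. The map `f` preserves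
both, is bijective on the second, and acts on the first by a scalar `c`. -/
theorem bijective_iff_apply_one_ne_zero (f : dickson p n →ₗ[SteenrodAlgebra p] dickson p n)
    (hf : IsDegreeZero (component p n (dickson p n)) f)
    (hbij : Set.BijOn f {x | MvPolynomial.constantCoeff (x : MvPolynomial (Fin n) (ZMod p)) = 0}
      {x | MvPolynomial.constantCoeff (x : MvPolynomial (Fin n) (ZMod p)) = 0}) :
    Function.Bijective f ↔ f ⟨1, one_mem_dickson p n⟩ ≠ 0 := by
  set e : dickson p n := ⟨1, one_mem_dickson p n⟩ with he
  have he0 : e ≠ 0 := fun h => one_ne_zero (congrArg Subtype.val h)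
  have hfe : ∃ c : ZMod p, f e = c • e := by
    have h := mem_component_iff.1 (hf _ e (mem_component_iff.2
      (MvPolynomial.isHomogeneous_one (Fin n) (ZMod p))))
    have h' := MvPolynomial.totalDegree_eq_zero_iff_eq_C.1 (Nat.le_zero.1 h.totalDegree_le)
    refine ⟨MvPolynomial.coeff 0 (f e : MvPolynomial (Fin n) (ZMod p)),
      Subtype.ext (h'.trans ?_)⟩
    change _ = _ • (1 : MvPolynomial (Fin n) (ZMod p))
    rw [MvPolynomial.smul_eq_C_mul, mul_one]
  obtain ⟨c, hc⟩ := hfe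
  have dec (z : dickson p n) :
      ∃ z' : dickson p n, MvPolynomial.constantCoeff (z' : MvPolynomial (Fin n) (ZMod p)) = 0 ∧
        ∃ r : ZMod p, z = r • e + z' := by
    refine ⟨z - MvPolynomial.constantCoeff (z : MvPolynomial (Fin n) (ZMod p)) • e, ?_,
      MvPolynomial.constantCoeff (z : MvPolynomial (Fin n) (ZMod p)),
      Subtype.ext (add_sub_cancel _ (z : MvPolynomial (Fin n) (ZMod p))).symm⟩
    rw [AddSubgroupClass.coe_sub, map_sub]
    change _ - MvPolynomial.constantCoeff
      (MvPolynomial.constantCoeff (z : MvPolynomial (Fin n) (ZMod p)) •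
        (1 : MvPolynomial (Fin n) (ZMod p))) = 0
    rw [MvPolynomial.constantCoeff_smul]
    simp
  refine ⟨fun h h0 => he0 (h.1 (h0.trans (map_zero f).symm)), fun h => ?_⟩
  have hc0 : c ≠ 0 := by
    rintro rfl
    exact h (hc.trans (zero_smul _ _))
  refine ⟨fun x y hxy => eq_of_sub_eq_zero ?_, fun y => ?_⟩
  · have hz := apply_sub_eq_zero hxy
    generalize x - y = z at hz ⊢
    obtain ⟨z', hz', r, rfl⟩ := dec z
    rw [map_add, apply_zmod_smul, hc] at hz
    have h1 : MvPolynomial.constantCoeff (r • c • (1 : MvPolynomial (Fin n) (ZMod p)) +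
        (f z' : MvPolynomial (Fin n) (ZMod p))) = 0 :=
      (congrArg (fun w : dickson p n =>
        MvPolynomial.constantCoeff (w : MvPolynomial (Fin n) (ZMod p))) hz).trans (map_zero _)
    have h2 : MvPolynomial.constantCoeff (f z' : MvPolynomial (Fin n) (ZMod p)) = 0 :=
      hbij.mapsTo hz'
    rw [map_add, h2, MvPolynomial.constantCoeff_smul, MvPolynomial.constantCoeff_smul, map_one,
      add_zero, smul_eq_mul, smul_eq_mul, mul_one] at h1
    have hr : r = 0 := (mul_eq_zero.1 h1).resolve_right hc0
    rw [hr, zero_smul, zero_add] at hz ⊢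
    exact hbij.injOn hz' (by simp) (hz.trans (map_zero f).symm)
  · obtain ⟨y', hy', r, rfl⟩ := dec y
    obtain ⟨z', -, rfl⟩ := hbij.surjOn hy'
    refine ⟨(r / c) • e + z', ?_⟩
    rw [map_add, apply_zmod_smul, hc, smul_smul, div_mul_cancel₀ _ hc0]

theorem isAtomic_augmentation :
    IsAtomic (SteenrodAlgebra p) (component p n (augmentation p n)) := by
  intro f hf r hr hbij
  have hN : ∀ x ∈ augmentation p n, ∀ m, MvPolynomial.homogeneousComponent m x ∈ augmentation p n :=
    fun x hx m => homogeneousComponent_mem_augmentation hx m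
  obtain ⟨w, hw, hw0⟩ := (Submodule.ne_bot_iff _).1 hr.1.2
  obtain ⟨m', rfl⟩ := exists_isHomogeneous_of_mem_component hw hw0
  have hfin : Finite (component p n (augmentation p n) (genDegree p * m') :
      Set (augmentation p n)) :=
    Set.Finite.subset ((finite_isHomogeneous m').preimage Subtype.val_injective.injOn)
      fun x hx => mem_component_iff.1 hx
  -- On the finite lowest component `f` is a permutation, so a positive power of it fixes `w`. That
  -- power would kill the common multiple `b • w` of `w` and a kernel element, while also fixing it.
  obtain ⟨j, hj, hjw⟩ : ∃ j, 0 < j ∧ (f ^ j : Module.End (SteenrodAlgebra p) (augmentation p n)) w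
      = w := by
    let π := hbij.equiv f
    have hπ (j : ℕ) : ((π ^ j : Equiv.Perm _) ⟨w, hw⟩ : augmentation p n) =
        (f ^ j : Module.End (SteenrodAlgebra p) (augmentation p n)) w := by
      induction j with
      | zero => rfl
      | succ j ih =>
        rw [pow_succ', pow_succ', Equiv.Perm.mul_apply, Module.End.mul_apply, ← ih]
        rfl
    refine ⟨orderOf π, orderOf_pos π, ?_⟩
    rw [← hπ, pow_orderOf_eq_one]
    rfl
  have h := bijOn_of_injective_homogeneous hf hN fun m x hm hc hfx => by_contra fun hx0 => by
    obtain ⟨a, b, hab, hne⟩ := exists_smul_eq_smul x.2 (fun h => hx0 (Subtype.ext h)) hm w.2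
      (fun h => hw0 (Subtype.ext h)) (mem_component_iff.1 hw)
    have hab' : a • x = b • w := Subtype.ext hab
    have h1 : (f ^ j : Module.End (SteenrodAlgebra p) (augmentation p n)) (b • w) = 0 := by
      obtain ⟨j, rfl⟩ : ∃ i, j = i + 1 := ⟨j - 1, by omega⟩
      rw [pow_succ, Module.End.mul_apply, ← hab', map_smul f, hfx, smul_zero, map_zero]
    rw [map_smul, hjw, ← hab'] at h1
    exact hne (congrArg Subtype.val h1)
  have huniv : {x : augmentation p n | MvPolynomial.constantCoeff
      (x : MvPolynomial (Fin n) (ZMod p)) = 0} = Set.univ :=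
    Set.eq_univ_of_forall fun x => x.2.2
  rw [huniv] at h
  exact Set.bijOn_univ.1 h

end Main

end Dickson

theorem mainTheorem5 (p : ℕ) [Fact p.Prime] (n : ℕ) (hn : 1 ≤ n) :
    (∀ f : Dickson.dickson p n →ₗ[Dickson.SteenrodAlgebra p] Dickson.dickson p n,
      Dickson.IsDegreeZero (Dickson.component p n (Dickson.dickson p n)) f →
      f ⟨Dickson.dicksonInvariant p n 1, Dickson.dicksonInvariant_mem 1⟩ ≠ 0 →
        Set.BijOn f {x | (x : MvPolynomial (Fin n) (ZMod p)) ∈ Dickson.augmentation p n}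
          {x | (x : MvPolynomial (Fin n) (ZMod p)) ∈ Dickson.augmentation p n} ∧
        (Function.Bijective f ↔ f ⟨1, Dickson.one_mem_dickson p n⟩ ≠ 0)) ∧
    Dickson.IsAtomic (Dickson.SteenrodAlgebra p)
      (Dickson.component p n (Dickson.augmentation p n)) := by
  refine ⟨fun f hf hfd => ?_, Dickson.isAtomic_augmentation⟩
  have h := Dickson.bijOn_augmentation hn f hf hfd
  have e : {x : Dickson.dickson p n | (x : MvPolynomial (Fin n) (ZMod p)) ∈
      Dickson.augmentation p n} =
      {x : Dickson.dickson p n |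
        MvPolynomial.constantCoeff (x : MvPolynomial (Fin n) (ZMod p)) = 0} :=
    Set.ext fun x => ⟨fun hx => hx.2, fun hx => ⟨x.2, hx⟩⟩
  rw [e]
  exact ⟨h, Dickson.bijective_iff_apply_one_ne_zero f hf h⟩
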